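/- Let $\nu>0$, let $\bar\Omega$ be a positive definite $d\times d$ correlation matrix, $\alpha\in\mathbb R^d$, $\tau\in\mathbb R$, and let $W=(W_1,\dots,W_d)$ be an extended skew-normal vector $SN_d(\bar\Omega,\alpha,\tau)$, i.e. with density $$w\mapsto \frac{\phi_d(w;\bar\Omega)\,\Phi(\alpha^\top w+\tau)}{\Phi\big(\tau\,(1+\alpha^\top\bar\Omega\alpha)^{-1/2}\big)},$$ where $\phi_d(\cdot;\bar\Omega)$ is the centred normal density with covariance matrix $\bar\Omega$ and $\Phi$ is the standard normal cdf. Put $x_+=\max(x,0)$, $m_{i+}=\mathbb E[(W_i)_+^\nu]$, and let $$V(\mathbf z)=\mathbb E\Big[\max_{1\le i\le d}\frac{(W_i)_+^{\nu}}{z_i\,m_{i+}}\Big],\qquad \mathbf z\in(0,\infty)^d,$$ be the exponent function of the extremal skew-$t$ model with unit Fréchet margins. Let $\Psi(\cdot;\kappa,n)$ be the cdf of the univariate non-central $t$ distribution with non-centrality $\kappa$ and $n$ degrees of freedom. For $\Omega$ a $k\times k$ scale matrix with $\omega=\mathrm{diag}(\Omega)^{1/2}$ and $R=\omega^{-1}\Omega\,\omega^{-1}$,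 let $\Psi_k(\cdot;\mu,\Omega,a,t,\kappa,n)$ be the cdf of the $k$-dimensional non-central extended skew-$t$ distribution, whose density at $y$ is, with $x=\omega^{-1}(y-\mu)$, $$\frac{\psi_k(y;\mu,\Omega,n)}{\Psi\Big(\frac{t}{\sqrt{1+a^\top Ra}};\frac{\kappa}{\sqrt{1+a^\top Ra}},n\Big)}\;\Psi\Big((a^\top x+t)\sqrt{\tfrac{n+k}{n+x^\top R^{-1}x}};\kappa,n+k\Big),$$ where $\psi_k(\cdot;\mu,\Omega,n)$ is the $k$-dimensional $t$ density with location $\mu$, scale matrix $\Omega$ and $n$ degrees of freedom; $\Psi_0=1$. Let $A\subseteq\{1,\dots,d\}$ be non-empty with $m$ elements and let $B$ be its complement (the case $A=\{1,\dots,m\}$ gives $V_{1:m}$). Write $z_i^\circ=(z_i m_{i+})^{1/\nu}$ and $$Q=\mathbf z_A^{\circ\top}\bar\Omega_A^{-1}\mathbf z_A^\circ,\quad \tilde\Omega=\bar\Omega_B-\bar\Omega_{BA}\bar\Omega_A^{-1}\bar\Omega_{AB},\quad \beta=\alpha_A+\bar\Omega_A^{-1}\bar\Omega_{AB}\alpha_B,$$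 $$\alpha_A^*=\frac{\beta}{\sqrt{1+\alpha_B^\top\tilde\Omega\alpha_B}},\quad \tau_A^*=\frac{\tau}{\sqrt{1+\alpha_B^\top\tilde\Omega\alpha_B}},\quad \tilde\alpha_A=\alpha_A^{*\top}\mathbf z_A^\circ\,Q^{-1/2},$$ $$\nu_c=\nu+m,\quad \mu_c=\bar\Omega_{BA}\bar\Omega_A^{-1}\mathbf z_A^\circ,\quad \Omega_c=\frac{Q}{\nu_c}\tilde\Omega,\quad \alpha_c=\mathrm{diag}(\tilde\Omega)^{1/2}\alpha_B,\quad \tau_c=\beta^\top\mathbf z_A^\circ\,(\nu+m)^{1/2}Q^{-1/2},\quad \kappa_c=-\tau.$$ Then the mixed partial derivative $V_A=\partial^m V/\prod_{i\in A}\partial z_i$ exists on $(0,\infty)^d$, with the differentiations taken in any order, and $$-V_A(\mathbf z)=\Psi_{d-m}\big(\mathbf z_B^\circ;\mu_c,\Omega_c,\alpha_c,\tau_c,\kappa_c,\nu_c\big)\;\frac{2^{(\nu-2)/2}\,\nu^{-m+1}\,\Gamma\big(\frac{m+\nu}{2}\big)\,\Psi\big(\tilde\alpha_A\sqrt{m+\nu};-\tau_A^*,m+\nu\big)\prod_{i\in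 A}\big(m_{i+}z_i^{1-\nu}\big)^{1/\nu}}{\pi^{m/2}\,|\bar\Omega_A|^{1/2}\,Q^{(m+\nu)/2}\,\Phi\big(\tau_A^*\{1+\alpha_A^{*\top}\bar\Omega_A\alpha_A^*\}^{-1/2}\big)}.$$ -/

import Mathlib

open MeasureTheory ProbabilityTheory
open scoped Matrix

noncomputable section

namespace ExtremalSkewT

variable {ι : Type*} [Fintype ι] [DecidableEq ι]

/-! ### Univariate distribution functions -/

/-- The standard normal cdf `Φ`. -/
def stdNormalCDF (x : ℝ) : ℝ :=
  (gaussianReal 0 1).real (Set.Iic x)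

/-- The chi-squared law with `n > 0` (real) degrees of freedom: Gamma with shape `n / 2`
and rate `1 / 2`. -/
def chiSquaredLaw (n : ℝ) : Measure ℝ :=
  gammaMeasure (n / 2) (1 / 2)

/-- The non-central `t` law with non-centrality `κ` and `n` degrees of freedom: the law of
`(N + κ) / √(S / n)`, with `N` standard normal, `S` chi-squared with `n` degrees of freedom,
independent. -/
def noncentralTLaw (κ n : ℝ) : Measure ℝ :=
  ((gaussianReal κ 1).prod (chiSquaredLaw n)).map (fun p => p.1 / √(p.2 / n))

/-- The univariate non-central `t` cdf `Ψ(x; κ, n)`. -/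
def noncentralTCDF (x κ n : ℝ) : ℝ :=
  (noncentralTLaw κ n).real (Set.Iic x)

/-! ### Multivariate densities -/

/-- The quadratic form `xᵀ A x`. -/
def quadForm (A : Matrix ι ι ℝ) (x : ι → ℝ) : ℝ :=
  x ⬝ᵥ (A *ᵥ x)

/-- The centred normal density with covariance matrix `Ω`. -/
def gaussianDensity (Ω : Matrix ι ι ℝ) (w : ι → ℝ) : ℝ :=
  (√((2 * Real.pi) ^ Fintype.card ι * Ω.det))⁻¹ * Real.exp (-(quadForm Ω⁻¹ w) / 2)

/-- The density of the extended skew-normal distribution `SN(Ω, α, τ)` with correlation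
matrix `Ω`, slant `α` and extension `τ`. -/
def extSkewNormalDensity (Ω : Matrix ι ι ℝ) (α : ι → ℝ) (τ : ℝ) (w : ι → ℝ) : ℝ :=
  gaussianDensity Ω w * stdNormalCDF (α ⬝ᵥ w + τ) / stdNormalCDF (τ / √(1 + quadForm Ω α))

/-- The extended skew-normal distribution `SN(Ω, α, τ)`. -/
def extSkewNormal (Ω : Matrix ι ι ℝ) (α : ι → ℝ) (τ : ℝ) : Measure (ι → ℝ) :=
  volume.withDensity (fun w => ENNReal.ofReal (extSkewNormalDensity Ω α τ w))

/-- The density of the multivariate `t` distribution with location `μ`, scale matrix `Ω` and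
`n` degrees of freedom. -/
def multivariateTDensity (μ : ι → ℝ) (Ω : Matrix ι ι ℝ) (n : ℝ) (y : ι → ℝ) : ℝ :=
  Real.Gamma ((n + Fintype.card ι) / 2) /
      (Real.Gamma (n / 2) * (n * Real.pi) ^ ((Fintype.card ι : ℝ) / 2) * √Ω.det) *
    (1 + quadForm Ω⁻¹ (y - μ) / n) ^ (-((n + Fintype.card ι) / 2))

/-- The correlation matrix `ω⁻¹ Ω ω⁻¹`, `ω = diag(Ω)^{1/2}`, of a scale matrix `Ω`. -/
def correlation (Ω : Matrix ι ι ℝ) : Matrix ι ι ℝ :=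
  Matrix.of fun i j => Ω i j / (√(Ω i i) * √(Ω j j))

/-- The density of the non-central extended skew-`t` distribution with location `μ`, scale
matrix `Ω`, slant `α`, extension `τ`, non-centrality `κ` and `n` degrees of freedom. -/
def extSkewTDensity (μ : ι → ℝ) (Ω : Matrix ι ι ℝ) (α : ι → ℝ) (τ κ n : ℝ) (y : ι → ℝ) : ℝ :=
  let z : ι → ℝ := fun i => (y i - μ i) / √(Ω i i)
  multivariateTDensity μ Ω n y /
      noncentralTCDF (τ / √(1 + quadForm (correlation Ω) α))
        (κ / √(1 + quadForm (correlation Ω) α)) n *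
    noncentralTCDF
      ((α ⬝ᵥ z + τ) * √((n + Fintype.card ι) / (n + quadForm (correlation Ω)⁻¹ z)))
      κ (n + Fintype.card ι)

/-- The cdf `Ψ_k(y; μ, Ω, α, τ, κ, n)` of the non-central extended skew-`t` distribution.
In dimension zero `ι → ℝ` is a point of volume one, and the value is `1`. -/
def extSkewTCDF (μ : ι → ℝ) (Ω : Matrix ι ι ℝ) (α : ι → ℝ) (τ κ n : ℝ) (y : ι → ℝ) : ℝ :=
  ∫ x in Set.Iic y, extSkewTDensity μ Ω α τ κ n x

/-! ### The exponent function -/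

/-- `m_{i+} = E[(W_i)_+ ^ ν]`. -/
def plusMoment {Ω' : Type*} [MeasurableSpace Ω'] (P : Measure Ω') (W : Ω' → ι → ℝ) (ν : ℝ)
    (i : ι) : ℝ :=
  ∫ ω, (max (W ω i) 0) ^ ν ∂P

/-- The exponent function (unit Fréchet margins) of the max-stable model with spectral
vector `W`: `V(z) = E[max_i (W_i)_+ ^ ν / (z_i m_{i+})]`. -/
def exponentFunction {Ω' : Type*} [MeasurableSpace Ω'] (P : Measure Ω') (W : Ω' → ι → ℝ) (ν : ℝ)
    (z : ι → ℝ) : ℝ :=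
  ∫ ω, ⨆ i, (max (W ω i) 0) ^ ν / (z i * plusMoment P W ν i) ∂P

/-! ### Iterated partial derivatives -/

/-- `IsIteratedPartial U [i₁, …, iₖ] f g`: on `U` the iterated partial derivative
`∂_{i₁} (∂_{i₂} (⋯ (∂_{iₖ} f)))` exists (every inner derivative existing on all of `U`) and
equals `g`. -/
def IsIteratedPartial (U : Set (ι → ℝ)) :
    List ι → ((ι → ℝ) → ℝ) → ((ι → ℝ) → ℝ) → Prop
  | [], f, g => Set.EqOn f g U
  | i :: l, f, g => ∃ h : (ι → ℝ) → ℝ, IsIteratedPartial U l f h ∧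
      ∀ z ∈ U, HasDerivAt (fun t : ℝ => h (Function.update z i t)) (g z) (z i)

/-! ### The closed form

`A` is the set of the differentiated coordinates, `Aᶜ` its complement; `mp i` stands for
`m_{i+}`. -/

/-- The coordinates in `A`. -/
def restr (A : Finset ι) (x : ι → ℝ) : A → ℝ := fun i => x i

/-- The block of `M` with rows in `A` and columns in `B`. -/
def block (M : Matrix ι ι ℝ) (A B : Finset ι) : Matrix A B ℝ :=
  M.submatrix (fun i => (i : ι)) (fun j => (j : ι))

/-- `z°_i = (z_i m_{i+})^{1/ν}`. -/
def circ (ν : ℝ) (mp z : ι → ℝ) : ι → ℝ := fun i => (z i * mp i) ^ (1 / ν)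

/-- `Q = z°_Aᵀ Ω_A⁻¹ z°_A`. -/
def condQ (Ω : Matrix ι ι ℝ) (ν : ℝ) (mp z : ι → ℝ) (A : Finset ι) : ℝ :=
  quadForm (block Ω A A)⁻¹ (restr A (circ ν mp z))

/-- The Schur complement `Ω̃ = Ω_B - Ω_BA Ω_A⁻¹ Ω_AB`, `B = Aᶜ`. -/
def condSchur (Ω : Matrix ι ι ℝ) (A : Finset ι) :
    Matrix (Aᶜ : Finset ι) (Aᶜ : Finset ι) ℝ :=
  block Ω Aᶜ Aᶜ - block Ω Aᶜ A * (block Ω A A)⁻¹ * block Ω A Aᶜ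

/-- `α_A + Ω_A⁻¹ Ω_AB α_B`. -/
def mergedSlant (Ω : Matrix ι ι ℝ) (α : ι → ℝ) (A : Finset ι) : A → ℝ :=
  restr A α + ((block Ω A A)⁻¹ * block Ω A Aᶜ) *ᵥ restr Aᶜ α

/-- The marginal slant `α*_A`. -/
def margSlant (Ω : Matrix ι ι ℝ) (α : ι → ℝ) (A : Finset ι) : A → ℝ :=
  (√(1 + quadForm (condSchur Ω A) (restr Aᶜ α)))⁻¹ • mergedSlant Ω α A

/-- The marginal extension `τ*_A`. -/
def margExtension (Ω : Matrix ι ι ℝ) (α : ι → ℝ) (τ : ℝ) (A : Finset ι) : ℝ :=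
  τ / √(1 + quadForm (condSchur Ω A) (restr Aᶜ α))

/-- `μ_c = Ω_BA Ω_A⁻¹ z°_A`. -/
def condLocation (Ω : Matrix ι ι ℝ) (ν : ℝ) (mp z : ι → ℝ) (A : Finset ι) :
    (Aᶜ : Finset ι) → ℝ :=
  (block Ω Aᶜ A * (block Ω A A)⁻¹) *ᵥ restr A (circ ν mp z)

/-- `ν_c = ν + |A|`. -/
def condDof (ν : ℝ) (A : Finset ι) : ℝ := ν + A.card

/-- `Ω_c = (Q / ν_c) Ω̃`. -/
def condScale (Ω : Matrix ι ι ℝ) (ν : ℝ) (mp z : ι → ℝ) (A : Finset ι) :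
    Matrix (Aᶜ : Finset ι) (Aᶜ : Finset ι) ℝ :=
  (condQ Ω ν mp z A / condDof ν A) • condSchur Ω A

/-- `α_c = diag(Ω̃)^{1/2} α_B`. -/
def condSlant (Ω : Matrix ι ι ℝ) (α : ι → ℝ) (A : Finset ι) : (Aᶜ : Finset ι) → ℝ :=
  fun j => √(condSchur Ω A j j) * α j

/-- `τ_c = (α_A + Ω_A⁻¹ Ω_AB α_B)ᵀ z°_A (ν + |A|)^{1/2} Q^{-1/2}`. -/
def condExtension (Ω : Matrix ι ι ℝ) (α : ι → ℝ) (ν : ℝ) (mp z : ι → ℝ) (A : Finset ι) : ℝ :=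
  (mergedSlant Ω α A ⬝ᵥ restr A (circ ν mp z)) * √(ν + A.card) / √(condQ Ω ν mp z A)

/-- The factor `Ψ_{d-m}(z°_B; μ_c, Ω_c, α_c, τ_c, κ_c, ν_c)`, with `κ_c = -τ`. -/
def condSkewTCDF (Ω : Matrix ι ι ℝ) (α : ι → ℝ) (τ ν : ℝ) (mp z : ι → ℝ) (A : Finset ι) : ℝ :=
  extSkewTCDF (condLocation Ω ν mp z A) (condScale Ω ν mp z A) (condSlant Ω α A)
    (condExtension Ω α ν mp z A) (-τ) (condDof ν A) (restr Aᶜ (circ ν mp z))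

/-- `α̃_A = α*_Aᵀ z°_A Q^{-1/2}`. -/
def alphaTilde (Ω : Matrix ι ι ℝ) (α : ι → ℝ) (ν : ℝ) (mp z : ι → ℝ) (A : Finset ι) : ℝ :=
  (margSlant Ω α A ⬝ᵥ restr A (circ ν mp z)) / √(condQ Ω ν mp z A)

/-- The `m`-dimensional marginal intensity, `m = |A|`. -/
def marginalIntensity (Ω : Matrix ι ι ℝ) (α : ι → ℝ) (τ ν : ℝ) (mp z : ι → ℝ)
    (A : Finset ι) : ℝ :=
  (2 ^ ((ν - 2) / 2) * ν ^ (-(A.card : ℝ) + 1) * Real.Gamma ((A.card + ν) / 2) *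
      noncentralTCDF (alphaTilde Ω α ν mp z A * √(A.card + ν)) (-margExtension Ω α τ A)
        (A.card + ν) *
      ∏ i ∈ A, (mp i * z i ^ (1 - ν)) ^ (1 / ν)) /
    (Real.pi ^ ((A.card : ℝ) / 2) * √(block Ω A A).det *
      condQ Ω ν mp z A ^ ((A.card + ν) / 2) *
      stdNormalCDF (margExtension Ω α τ A / √(1 + quadForm (block Ω A A) (margSlant Ω α A))))

end ExtremalSkewT

end

open MeasureTheory ProbabilityTheory
open scoped Matrix

noncomputable section

namespace ExtremalSkewT

/-! ### The standard normal and the non-central `t` distribution functions -/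

/-! The exponent function is the mass that a homogeneous measure, the exponent measure, gives to the
set of points exceeding `u = circ ν mp z` in some coordinate. If `M` is nonnegative and positively
homogeneous and `f` is the density of `W`, the layer-cake formula followed by the substitution `w =
s x` turns `E[M(W)^ν]` into the integral over `{M > 1}` of `∫₀^∞ ν s^(ν+d-1) f(s x) ds`
(`lintegral_rpow_extSkewNormal`). For the extended skew-normal `f` this ray integral is explicit: up
to constants it is `q ^ (-(ν+d)/2)`, with `q = quadForm Ω⁻¹ x`, times a non-central `t` cdf
(`lintegral_ray_eq`). Taking `M` to be the maximum of `(x_i)_+ / u_i` gives `exponentFunction_eq`.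

Differentiation is then the fundamental theorem of calculus, one coordinate at a time. The first
derivative in `u_j` is minus the integral of the density over the face `x_j = u_j`, `x_i ≤ u_i` for
the other `i`; each further derivative freezes one more coordinate (`hasDerivAt_exceedanceIntegral`,
`hasDerivAt_orthantIntegral`). The bound of the density by a multiple of `‖x‖ ^ (-(ν+d))` supplies
finiteness and continuity as long as some coordinate stays away from zero. The chain rule
contributes the derivatives of `z ↦ u`.

What remains is pointwise algebra (`extSkewTDensity_mul_marginalIntensity`): with the coordinates in
`A` frozen, the density times these derivatives is the marginal intensity times the conditional
extended skew-`t` density. Schur complements split the quadratic form, the determinant and the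
slant. The non-central `t` factor normalising the skew-`t` density is the one in the marginal
intensity, so the two cancel and the total mass of the skew-`t` density is never needed. The answer
depends only on the set of differentiated coordinates, hence not on the order. -/

theorem stdNormalCDF_nonneg (x : ℝ) : 0 ≤ stdNormalCDF x := measureReal_nonneg

theorem stdNormalCDF_le_one (x : ℝ) : stdNormalCDF x ≤ 1 := measureReal_le_one

theorem stdNormalCDF_pos (x : ℝ) : 0 < stdNormalCDF x := by
  refine ENNReal.toReal_pos (fun h => ?_) (measure_ne_top _ _)
  have := gaussianReal_absolutelyContinuous' 0 (one_ne_zero (α := NNReal)) h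
  simp at this

theorem stdNormalCDF_continuous : Continuous stdNormalCDF := by
  have h : stdNormalCDF = fun x => ∫ t in Set.Iic x, gaussianPDFReal 0 1 t := by
    funext x
    rw [stdNormalCDF, measureReal_def, gaussianReal_apply_eq_integral _ one_ne_zero,
      ENNReal.toReal_ofReal]
    exact setIntegral_nonneg measurableSet_Iic fun t _ => gaussianPDFReal_nonneg _ _ _
  rw [h]
  have hi : Integrable (gaussianPDFReal 0 1) := integrable_gaussianPDFReal 0 1
  have h2 : (fun x => ∫ t in Set.Iic x, gaussianPDFReal 0 1 t) =
      fun x => (∫ t in Set.Iic (0 : ℝ), gaussianPDFReal 0 1 t) +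
        ∫ t in (0 : ℝ)..x, gaussianPDFReal 0 1 t := by
    funext x
    rw [← intervalIntegral.integral_Iic_sub_Iic hi.integrableOn hi.integrableOn]
    ring
  rw [h2]
  exact continuous_const.add
    (intervalIntegral.continuous_primitive (fun _ _ => hi.intervalIntegrable) 0)

theorem gaussianReal_Iic (κ x : ℝ) :
    gaussianReal κ 1 (Set.Iic x) = ENNReal.ofReal (stdNormalCDF (x - κ)) := by
  have h := gaussianReal_map_const_add (μ := 0) (v := 1) κ
  rw [zero_add] at h
  rw [← h, Measure.map_apply (by fun_prop) measurableSet_Iic, stdNormalCDF,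
    ofReal_measureReal]
  congr 1
  ext y
  simp [le_sub_iff_add_le']

theorem chiSquaredLaw_isProbabilityMeasure {n : ℝ} (hn : 0 < n) :
    IsProbabilityMeasure (chiSquaredLaw n) :=
  isProbabilityMeasure_gammaMeasure (by positivity) (by norm_num)

theorem lintegral_chiSquaredLaw {n : ℝ} (g : ℝ → ENNReal) (hg : Measurable g) :
    ∫⁻ s, g s ∂(chiSquaredLaw n) = ∫⁻ s in Set.Ioi 0,
      ENNReal.ofReal (gammaPDFReal (n / 2) (1 / 2) s) * g s := by
  rw [chiSquaredLaw, gammaMeasure, lintegral_withDensity_eq_lintegral_mul _ (by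
    exact (measurable_gammaPDFReal _ _).ennreal_ofReal) hg, setLIntegral_congr Ioi_ae_eq_Ici,
    ← lintegral_indicator measurableSet_Ici]
  congr 1
  funext s
  by_cases hs : 0 ≤ s
  · simp [hs, gammaPDF]
  · simp [hs, gammaPDF, gammaPDFReal]

theorem ae_pos_chiSquaredLaw (n : ℝ) : ∀ᵐ s ∂(chiSquaredLaw n), 0 < s := by
  rw [ae_iff, ← lintegral_indicator_one (by measurability),
    lintegral_chiSquaredLaw _ (measurable_one.indicator (by measurability)),
    setLIntegral_congr_fun (g := 0) measurableSet_Ioi]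
  · simp
  · intro s hs
    simp only [Set.mem_Ioi] at hs
    simp [hs]

/-- Condition on the chi-squared variable: for `s > 0` the event `(N + κ) / √(s / n) ≤ x` is a
half-line for the normal variable. -/
theorem ofReal_noncentralTCDF {n : ℝ} (hn : 0 < n) (x κ : ℝ) :
    ENNReal.ofReal (noncentralTCDF x κ n) =
      ∫⁻ s, ENNReal.ofReal (stdNormalCDF (x * √(s / n) - κ)) ∂(chiSquaredLaw n) := by
  have := chiSquaredLaw_isProbabilityMeasure hn
  have hm : Measurable (fun p : ℝ × ℝ => p.1 / √(p.2 / n)) := by fun_prop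
  have : IsProbabilityMeasure (noncentralTLaw κ n) :=
    Measure.isProbabilityMeasure_map hm.aemeasurable
  rw [noncentralTCDF, ofReal_measureReal, noncentralTLaw, Measure.map_apply hm measurableSet_Iic,
    Measure.prod_apply_symm (hm measurableSet_Iic)]
  refine lintegral_congr_ae ?_
  filter_upwards [ae_pos_chiSquaredLaw n] with s hs
  rw [← gaussianReal_Iic]
  congr 1
  ext y
  have : 0 < √(s / n) := by positivity
  simp [div_le_iff₀ this]

theorem noncentralTCDF_nonneg (x κ n : ℝ) : 0 ≤ noncentralTCDF x κ n := measureReal_nonneg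

theorem noncentralTCDF_eq_integral {n : ℝ} (hn : 0 < n) (x κ : ℝ) :
    noncentralTCDF x κ n = ∫ s, stdNormalCDF (x * √(s / n) - κ) ∂(chiSquaredLaw n) := by
  rw [integral_eq_lintegral_of_nonneg_ae (ae_of_all _ fun _ => stdNormalCDF_nonneg _),
    ← ofReal_noncentralTCDF hn, ENNReal.toReal_ofReal (noncentralTCDF_nonneg _ _ _)]
  have := stdNormalCDF_continuous.measurable
  exact Measurable.aestronglyMeasurable (by fun_prop)

theorem integrable_stdNormalCDF {E : Type*} [MeasurableSpace E] {μ : Measure E} [IsFiniteMeasure μ]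
    {f : E → ℝ} (hf : Measurable f) : Integrable (fun s => stdNormalCDF (f s)) μ := by
  refine Integrable.of_bound (stdNormalCDF_continuous.measurable.comp hf).aestronglyMeasurable 1
    (ae_of_all _ fun s => ?_)
  rw [Real.norm_of_nonneg (stdNormalCDF_nonneg _)]
  exact stdNormalCDF_le_one _

theorem noncentralTCDF_le_one {n : ℝ} (hn : 0 < n) (x κ : ℝ) : noncentralTCDF x κ n ≤ 1 := by
  have := chiSquaredLaw_isProbabilityMeasure hn
  rw [noncentralTCDF_eq_integral hn]
  calc _ ≤ ∫ s, (1 : ℝ) ∂(chiSquaredLaw n) :=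
        integral_mono (integrable_stdNormalCDF (by fun_prop)) (integrable_const _)
          fun s => stdNormalCDF_le_one _
    _ = 1 := by simp

theorem noncentralTCDF_pos {n : ℝ} (hn : 0 < n) (x κ : ℝ) : 0 < noncentralTCDF x κ n := by
  have := chiSquaredLaw_isProbabilityMeasure hn
  rw [noncentralTCDF_eq_integral hn, integral_pos_iff_support_of_nonneg
    (fun s => stdNormalCDF_nonneg _) (integrable_stdNormalCDF (by fun_prop))]
  have : Function.support (fun s => stdNormalCDF (x * √(s / n) - κ)) = Set.univ :=
    Set.eq_univ_of_forall fun s => (stdNormalCDF_pos _).ne'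
  simp [this]

theorem noncentralTCDF_continuous {n : ℝ} (hn : 0 < n) (κ : ℝ) :
    Continuous fun x => noncentralTCDF x κ n := by
  have := chiSquaredLaw_isProbabilityMeasure hn
  simp_rw [noncentralTCDF_eq_integral hn]
  refine continuous_of_dominated (bound := fun _ => 1)
    (fun x => (integrable_stdNormalCDF (by fun_prop)).aestronglyMeasurable)
    (fun x => ae_of_all _ fun s => ?_) (integrable_const _) (ae_of_all _ fun s => ?_)
  · rw [Real.norm_of_nonneg (stdNormalCDF_nonneg _)]
    exact stdNormalCDF_le_one _
  · exact stdNormalCDF_continuous.comp (by fun_prop)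

/-- Substituting `q s²` for the chi-squared variable turns the Gaussian factor into a chi-squared
density with `n` degrees of freedom, and the argument of the cdf, which contains `√(q s² / n)`,
becomes linear in `s`. -/
theorem lintegral_ray_eq {n q : ℝ} (hn : 0 < n) (hq : 0 < q) (a τ : ℝ) :
    ∫⁻ s in Set.Ioi (0 : ℝ), ENNReal.ofReal
        (s ^ (n - 1) * Real.exp (-(s ^ 2 * q) / 2) * stdNormalCDF (s * a + τ)) =
      ENNReal.ofReal (2 ^ (n / 2 - 1) * Real.Gamma (n / 2) * q ^ (-(n / 2)) *
        noncentralTCDF (a / √q * √n) (-τ) n) := by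
  have hG : 0 < Real.Gamma (n / 2) := Real.Gamma_pos_of_pos (by positivity)
  have hm := stdNormalCDF_continuous.measurable
  have himg : (fun s : ℝ => q * s ^ 2) '' Set.Ioi 0 = Set.Ioi 0 := by
    ext y
    simp only [Set.mem_image, Set.mem_Ioi]
    constructor
    · rintro ⟨s, hs, rfl⟩
      positivity
    · intro hy
      refine ⟨√(y / q), by positivity, ?_⟩
      rw [Real.sq_sqrt (by positivity)]
      field_simp
  rw [ENNReal.ofReal_mul (by positivity), ofReal_noncentralTCDF hn,
    lintegral_chiSquaredLaw _ (by fun_prop)]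
  conv_rhs => rw [← himg]
  rw [lintegral_image_eq_lintegral_abs_deriv_mul (f' := fun s => q * (2 * s)) measurableSet_Ioi,
    ← lintegral_const_mul' _ _ ENNReal.ofReal_ne_top]
  · refine setLIntegral_congr_fun measurableSet_Ioi fun s hs => ?_
    simp only [Set.mem_Ioi] at hs
    rw [← ENNReal.ofReal_mul' (stdNormalCDF_nonneg _), ← ENNReal.ofReal_mul (by positivity),
      ← ENNReal.ofReal_mul (by positivity)]
    congr 1
    have h1 : √(q * s ^ 2 / n) = √q * s / √n := by
      rw [Real.sqrt_div (by positivity), Real.sqrt_mul hq.le, Real.sqrt_sq hs.le]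
    have h2 : a / √q * √n * √(q * s ^ 2 / n) - -τ = s * a + τ := by
      rw [h1]
      field_simp
      ring
    have h3 : 0 ≤ q * s ^ 2 := by positivity
    rw [h2, gammaPDFReal, if_pos h3, abs_of_pos (by positivity), ← mul_assoc, ← mul_assoc]
    congr 1
    have e1 : -(1 / 2 * (q * s ^ 2)) = -(s ^ 2 * q) / 2 := by ring
    have e2 : (q * s ^ 2) ^ (n / 2 - 1) = q ^ (n / 2) / q * (s ^ (n - 1) / s) := by
      rw [Real.mul_rpow hq.le (by positivity), Real.rpow_sub_one hq.ne', ← Real.rpow_natCast,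
        ← Real.rpow_mul hs.le, ← Real.rpow_sub_one hs.ne']
      congr 2
      push_cast
      ring
    rw [e1, e2, Real.rpow_neg hq.le, Real.rpow_sub_one two_ne_zero,
      Real.div_rpow one_pos.le two_pos.le,
      Real.one_rpow]
    have := Real.rpow_pos_of_pos hq (n / 2)
    have := Real.rpow_pos_of_pos (two_pos (α := ℝ)) (n / 2)
    field_simp
  · intro s _
    have := ((hasDerivAt_pow 2 s).const_mul q).hasDerivWithinAt (s := Set.Ioi 0)
    simpa using this
  · intro s hs t ht h
    simp only [Set.mem_Ioi] at hs ht
    have : s ^ 2 = t ^ 2 := mul_left_cancel₀ hq.ne' h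
    exact (pow_left_inj₀ hs.le ht.le two_ne_zero).1 this

section

variable {ι : Type*} [Fintype ι] [DecidableEq ι]

/-! ### Block matrices and quadratic forms -/

theorem dotProduct_eq_restr_add (A : Finset ι) (x y : ι → ℝ) :
    x ⬝ᵥ y = restr A x ⬝ᵥ restr A y + restr Aᶜ x ⬝ᵥ restr Aᶜ y := by
  simp only [dotProduct, restr]
  rw [← Finset.sum_add_sum_compl A, Finset.sum_coe_sort A (fun i => x i * y i),
    Finset.sum_coe_sort Aᶜ (fun i => x i * y i)]

theorem restr_mulVec (M : Matrix ι ι ℝ) (A C : Finset ι) (x : ι → ℝ) :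
    restr C (M *ᵥ x) = block M C A *ᵥ restr A x + block M C Aᶜ *ᵥ restr Aᶜ x := by
  funext i
  exact dotProduct_eq_restr_add A (M i) x

theorem restr_ext (A : Finset ι) {x y : ι → ℝ} (h₁ : restr A x = restr A y)
    (h₂ : restr Aᶜ x = restr Aᶜ y) : x = y := by
  funext i
  by_cases hi : i ∈ A
  · exact congrFun h₁ ⟨i, hi⟩
  · exact congrFun h₂ ⟨i, Finset.mem_compl.2 hi⟩

/-- The vector with prescribed coordinates in `A` and in its complement. -/
def glue (A : Finset ι) (a : A → ℝ) (b : (Aᶜ : Finset ι) → ℝ) : ι → ℝ := fun i =>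
  if h : i ∈ A then a ⟨i, h⟩ else b ⟨i, Finset.mem_compl.2 h⟩

@[simp] theorem restr_glue (A : Finset ι) (a : A → ℝ) (b : (Aᶜ : Finset ι) → ℝ) :
    restr A (glue A a b) = a := by
  funext i
  simp [restr, glue]

@[simp] theorem restr_compl_glue (A : Finset ι) (a : A → ℝ) (b : (Aᶜ : Finset ι) → ℝ) :
    restr Aᶜ (glue A a b) = b := by
  funext i
  have := Finset.mem_compl.1 i.2
  simp [restr, glue, this]

theorem block_transpose {κ : Type*} {Ω : Matrix κ κ ℝ} (hΩ : Ω.PosDef) (A C : Finset κ) :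
    (block Ω A C)ᵀ = block Ω C A := by
  ext i j
  have := congrFun (congrFun hΩ.isHermitian i.1) j.1
  simpa [block, Matrix.conjTranspose_apply] using this

theorem block_posDef {κ : Type*} {Ω : Matrix κ κ ℝ} (hΩ : Ω.PosDef) (A : Finset κ) :
    (block Ω A A).PosDef := hΩ.submatrix Subtype.val_injective

theorem inv_mulVec_of_mulVec_eq {κ : Type*} [Fintype κ] [DecidableEq κ] {M : Matrix κ κ ℝ}
    (hM : IsUnit M.det) {v x : κ → ℝ} (h : M *ᵥ v = x) : M⁻¹ *ᵥ x = v := by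
  rw [← h, Matrix.mulVec_mulVec, Matrix.nonsing_inv_mul _ hM, Matrix.one_mulVec]

theorem mulVec_inv_mulVec {κ : Type*} [Fintype κ] [DecidableEq κ] {M : Matrix κ κ ℝ}
    (hM : IsUnit M.det) (x : κ → ℝ) : M *ᵥ (M⁻¹ *ᵥ x) = x := by
  rw [Matrix.mulVec_mulVec, Matrix.mul_nonsing_inv _ hM, Matrix.one_mulVec]

theorem isUnit_det_of_posDef {κ : Type*} [Fintype κ] [DecidableEq κ] {M : Matrix κ κ ℝ}
    (hM : M.PosDef) : IsUnit M.det := hM.det_pos.ne'.isUnit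

theorem inv_transpose_of_posDef {κ : Type*} [Fintype κ] [DecidableEq κ] {M : Matrix κ κ ℝ}
    (hM : M.PosDef) : M⁻¹ᵀ = M⁻¹ := by
  simpa [Matrix.conjTranspose_eq_transpose_of_trivial] using hM.inv.isHermitian.eq

theorem transpose_of_posDef {κ : Type*} {M : Matrix κ κ ℝ} (hM : M.PosDef) : Mᵀ = M := by
  simpa [Matrix.conjTranspose_eq_transpose_of_trivial] using hM.isHermitian.eq

theorem quadForm_pos {κ : Type*} [Fintype κ] [DecidableEq κ] {M : Matrix κ κ ℝ} (hM : M.PosDef)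
    {x : κ → ℝ} (hx : x ≠ 0) : 0 < quadForm M x := by
  simpa [quadForm] using hM.dotProduct_mulVec_pos hx

theorem quadForm_nonneg {κ : Type*} [Fintype κ] [DecidableEq κ] {M : Matrix κ κ ℝ}
    (hM : M.PosDef) (x : κ → ℝ) : 0 ≤ quadForm M x := by
  simpa [quadForm] using hM.posSemidef.dotProduct_mulVec_nonneg x

theorem dotProduct_mulVec_comm {κ μ : Type*} [Fintype κ] [Fintype μ] (M : Matrix κ μ ℝ)
    (x : κ → ℝ) (y : μ → ℝ) : x ⬝ᵥ (M *ᵥ y) = y ⬝ᵥ (Mᵀ *ᵥ x) := by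
  rw [Matrix.dotProduct_mulVec, Matrix.mulVec_transpose, dotProduct_comm]

/-- Cauchy–Schwarz for the inner product defined by `Ω`, applied to `Ω⁻¹ x` and the `i`-th basis
vector. With unit diagonal it yields the tail bound of the exponent density. -/
theorem sq_le_diag_mul_quadForm_inv {Ω : Matrix ι ι ℝ} (hΩ : Ω.PosDef) (x : ι → ℝ) (i : ι) :
    x i ^ 2 ≤ Ω i i * quadForm Ω⁻¹ x := by
  set v := Ω⁻¹ *ᵥ x with hv
  have hx : Ω *ᵥ v = x := mulVec_inv_mulVec (isUnit_det_of_posDef hΩ) x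
  have hd : 0 < Ω i i := hΩ.diag_pos
  -- Expanded, this form equals `Ω i i * (Ω i i * quadForm Ω⁻¹ x - x i ^ 2)`.
  have h := quadForm_nonneg hΩ (Ω i i • v - x i • Pi.single i 1)
  have e1 : (Pi.single i (1 : ℝ)) ⬝ᵥ (Ω *ᵥ Pi.single i 1) = Ω i i := by simp
  have e2 : (Pi.single i (1 : ℝ)) ⬝ᵥ (Ω *ᵥ v) = x i := by rw [hx]; simp
  have e3 : v ⬝ᵥ (Ω *ᵥ Pi.single i 1) = x i := by
    rw [dotProduct_mulVec_comm, transpose_of_posDef hΩ, e2]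
  have e4 : v ⬝ᵥ (Ω *ᵥ v) = quadForm Ω⁻¹ x := by rw [hx, dotProduct_comm]; rfl
  simp only [quadForm, Matrix.mulVec_sub, Matrix.mulVec_smul, dotProduct_sub, sub_dotProduct,
    smul_dotProduct, dotProduct_smul, e1, e2, e3, smul_eq_mul] at h
  rw [e4] at h
  have : 0 ≤ Ω i i * (Ω i i * quadForm Ω⁻¹ x - x i ^ 2) := by
    unfold quadForm; unfold quadForm at h; linarith
  have := nonneg_of_mul_nonneg_right this hd
  linarith

theorem norm_sq_le_quadForm_inv {Ω : Matrix ι ι ℝ} (hΩ : Ω.PosDef) (hdiag : ∀ i, Ω i i = 1)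
    (x : ι → ℝ) : ‖x‖ ^ 2 ≤ quadForm Ω⁻¹ x := by
  refine (Real.le_sqrt (norm_nonneg x) (quadForm_nonneg hΩ.inv x)).1 ?_
  refine (pi_norm_le_iff_of_nonneg (Real.sqrt_nonneg _)).2 fun i => Real.le_sqrt_of_sq_le ?_
  simpa [hdiag i] using sq_le_diag_mul_quadForm_inv hΩ x i

/-- Completing the square in the `A`-coordinates; the completed variable is exactly `mergedSlant`.
This is why the normalising constant of the `A`-marginal agrees with that of the full vector. -/
theorem quadForm_eq_restr {Ω : Matrix ι ι ℝ} (hΩ : Ω.PosDef) (α : ι → ℝ) (A : Finset ι) :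
    quadForm Ω α = quadForm (block Ω A A) (mergedSlant Ω α A) +
      quadForm (condSchur Ω A) (restr Aᶜ α) := by
  have hA := block_posDef hΩ A
  have hu := isUnit_det_of_posDef hA
  simp only [quadForm, condSchur, mergedSlant]
  rw [dotProduct_eq_restr_add A, restr_mulVec Ω A, restr_mulVec Ω A]
  set a := restr A α
  set b := restr Aᶜ α
  have e1 : block Ω A A *ᵥ (((block Ω A A)⁻¹ * block Ω A Aᶜ) *ᵥ b) = block Ω A Aᶜ *ᵥ b := by
    rw [← Matrix.mulVec_mulVec, mulVec_inv_mulVec hu]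
  have e2 : (((block Ω A A)⁻¹ * block Ω A Aᶜ) *ᵥ b) ⬝ᵥ (block Ω A A *ᵥ a) =
      a ⬝ᵥ (block Ω A Aᶜ *ᵥ b) := by
    rw [dotProduct_mulVec_comm, transpose_of_posDef hA, e1]
  have e3 : (((block Ω A A)⁻¹ * block Ω A Aᶜ) *ᵥ b) ⬝ᵥ (block Ω A Aᶜ *ᵥ b) =
      b ⬝ᵥ ((block Ω Aᶜ A * (block Ω A A)⁻¹ * block Ω A Aᶜ) *ᵥ b) := by
    rw [← Matrix.mulVec_mulVec, ← Matrix.mulVec_mulVec, ← Matrix.mulVec_mulVec,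
      ← block_transpose hΩ A Aᶜ, dotProduct_mulVec_comm (block Ω A Aᶜ)ᵀ b,
      Matrix.transpose_transpose]
  have e4 : b ⬝ᵥ (block Ω Aᶜ A *ᵥ a) = a ⬝ᵥ (block Ω A Aᶜ *ᵥ b) := by
    rw [dotProduct_mulVec_comm, block_transpose hΩ]
  simp only [Matrix.mulVec_add, Matrix.sub_mulVec, dotProduct_add, add_dotProduct,
    dotProduct_sub, e1, e2, e3, e4]
  ring

theorem condSchur_posDef {Ω : Matrix ι ι ℝ} (hΩ : Ω.PosDef) (A : Finset ι) :
    (condSchur Ω A).PosDef := by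
  have hA := block_posDef hΩ A
  refine Matrix.PosDef.of_dotProduct_mulVec_pos ?_ fun x hx => ?_
  · rw [Matrix.IsHermitian, Matrix.conjTranspose_eq_transpose_of_trivial, condSchur,
      Matrix.transpose_sub, Matrix.transpose_mul, Matrix.transpose_mul,
      inv_transpose_of_posDef hA, block_transpose hΩ, block_transpose hΩ, block_transpose hΩ,
      Matrix.mul_assoc]
  -- The `A`-coordinates are chosen to make the merged slant vanish, so that only the Schur
  -- complement term survives.
  · have h := quadForm_eq_restr hΩ
      (glue A (-(((block Ω A A)⁻¹ * block Ω A Aᶜ) *ᵥ x)) x) A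
    have h0 : glue A (-(((block Ω A A)⁻¹ * block Ω A Aᶜ) *ᵥ x)) x ≠ 0 := by
      intro h0
      refine hx ?_
      rw [← restr_compl_glue A (-(((block Ω A A)⁻¹ * block Ω A Aᶜ) *ᵥ x)) x, h0]
      rfl
    have hp := quadForm_pos hΩ h0
    rw [h] at hp
    simpa [mergedSlant, quadForm] using hp

/-- The exponent of a Gaussian density splits into a marginal part in `x_A` and a conditional part
in the residual of `x_B` after regression on `x_A`. -/
theorem quadForm_inv_eq_restr {Ω : Matrix ι ι ℝ} (hΩ : Ω.PosDef) (x : ι → ℝ) (A : Finset ι) :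
    quadForm Ω⁻¹ x = quadForm (block Ω A A)⁻¹ (restr A x) +
      quadForm (condSchur Ω A)⁻¹
        (restr Aᶜ x - (block Ω Aᶜ A * (block Ω A A)⁻¹) *ᵥ restr A x) := by
  have hA := block_posDef hΩ A
  have hu := isUnit_det_of_posDef hA
  have hS := isUnit_det_of_posDef (condSchur_posDef hΩ A)
  set a := restr A x
  set b := restr Aᶜ x
  set r := b - (block Ω Aᶜ A * (block Ω A A)⁻¹) *ᵥ a with hr
  set w := (condSchur Ω A)⁻¹ *ᵥ r with hw
  have hw' : condSchur Ω A *ᵥ w = r := mulVec_inv_mulVec hS r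
  -- The solution of `Ω v = x` by block elimination; verifying it avoids computing the blocks of
  -- `Ω⁻¹`.
  set v := glue A ((block Ω A A)⁻¹ *ᵥ (a - block Ω A Aᶜ *ᵥ w)) w with hv
  have hx : Ω *ᵥ v = x := by
    refine restr_ext A ?_ ?_
    · rw [restr_mulVec Ω A, hv, restr_glue, restr_compl_glue, mulVec_inv_mulVec hu]
      simp [a]
    · rw [restr_mulVec Ω A, hv, restr_glue, restr_compl_glue]
      have : block Ω Aᶜ Aᶜ *ᵥ w = r +
          (block Ω Aᶜ A * (block Ω A A)⁻¹ * block Ω A Aᶜ) *ᵥ w := by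
        rw [← hw', condSchur, Matrix.sub_mulVec]
        simp
      rw [this, hr, Matrix.mulVec_sub, Matrix.mulVec_sub]
      simp only [Matrix.mulVec_mulVec, Matrix.mul_assoc]
      change _ = b
      abel
  have h1 : quadForm Ω⁻¹ x = x ⬝ᵥ v := by
    rw [quadForm, inv_mulVec_of_mulVec_eq (isUnit_det_of_posDef hΩ) hx]
  rw [h1, dotProduct_eq_restr_add A, hv, restr_glue, restr_compl_glue]
  change a ⬝ᵥ _ + b ⬝ᵥ w = a ⬝ᵥ _ + r ⬝ᵥ w
  have h2 : ((block Ω Aᶜ A * (block Ω A A)⁻¹) *ᵥ a) ⬝ᵥ w =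
      a ⬝ᵥ (((block Ω A A)⁻¹ * block Ω A Aᶜ) *ᵥ w) := by
    rw [dotProduct_comm, dotProduct_mulVec_comm, Matrix.transpose_mul, inv_transpose_of_posDef hA,
      block_transpose hΩ]
  rw [hr, sub_dotProduct, h2, Matrix.mulVec_sub, dotProduct_sub, Matrix.mulVec_mulVec]
  ring

theorem det_eq_block_mul_condSchur {Ω : Matrix ι ι ℝ} (hΩ : Ω.PosDef) (A : Finset ι) :
    Ω.det = (block Ω A A).det * (condSchur Ω A).det := by
  have hA := block_posDef hΩ A
  let _ := hA.isUnit.invertible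
  let e : A ⊕ (Aᶜ : Finset ι) ≃ ι := Equiv.ofBijective
    (Sum.elim (fun i => i.1) (fun i => i.1)) (by
      constructor
      · rintro (⟨i, hi⟩ | ⟨i, hi⟩) (⟨j, hj⟩ | ⟨j, hj⟩) h <;>
          simp only [Sum.elim_inl, Sum.elim_inr] at h <;> subst h
        · rfl
        · exact absurd hi (Finset.mem_compl.1 hj)
        · exact absurd hj (Finset.mem_compl.1 hi)
        · rfl
      · intro i
        by_cases hi : i ∈ A
        · exact ⟨Sum.inl ⟨i, hi⟩, rfl⟩
        · exact ⟨Sum.inr ⟨i, Finset.mem_compl.2 hi⟩, rfl⟩)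
  have h : Ω.submatrix e e =
      Matrix.fromBlocks (block Ω A A) (block Ω A Aᶜ) (block Ω Aᶜ A) (block Ω Aᶜ Aᶜ) := by
    ext (i | i) (j | j) <;> rfl
  rw [← Matrix.det_submatrix_equiv_self e, h, Matrix.det_fromBlocks₁₁, Matrix.invOf_eq_nonsing_inv]
  rfl

/-! ### Rescaled matrices and correlation matrices -/

theorem quadForm_inv_smul {κ : Type*} [Fintype κ] [DecidableEq κ] {M : Matrix κ κ ℝ}
    (hM : IsUnit M.det) {c : ℝ} (hc : c ≠ 0) (x : κ → ℝ) :
    quadForm (c • M)⁻¹ x = c⁻¹ * quadForm M⁻¹ x := by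
  have : (c • M)⁻¹ *ᵥ x = c⁻¹ • (M⁻¹ *ᵥ x) := by
    refine inv_mulVec_of_mulVec_eq ?_ ?_
    · rw [Matrix.det_smul]
      exact (pow_ne_zero _ hc).isUnit.mul hM
    · rw [Matrix.mulVec_smul, Matrix.smul_mulVec, mulVec_inv_mulVec hM, smul_smul,
        inv_mul_cancel₀ hc, one_smul]
  rw [quadForm, this, dotProduct_smul, smul_eq_mul, quadForm]

theorem correlation_smul {κ : Type*} (M : Matrix κ κ ℝ) {c : ℝ} (hc : 0 < c) :
    correlation (c • M) = correlation M := by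
  ext i j
  simp only [correlation, Matrix.of_apply, Matrix.smul_apply, smul_eq_mul]
  rw [Real.sqrt_mul hc.le, Real.sqrt_mul hc.le]
  have : c = √c * √c := (Real.mul_self_sqrt hc.le).symm
  rw [mul_mul_mul_comm, ← this, mul_div_mul_left _ _ hc.ne']

theorem quadForm_correlation {κ : Type*} [Fintype κ] [DecidableEq κ] {M : Matrix κ κ ℝ}
    (hM : M.PosDef) (x : κ → ℝ) :
    quadForm (correlation M) (fun j => √(M j j) * x j) = quadForm M x := by
  have hd : ∀ i, 0 < √(M i i) := fun i => Real.sqrt_pos.2 hM.diag_pos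
  simp only [quadForm, dotProduct, Matrix.mulVec, correlation, Matrix.of_apply, Finset.mul_sum]
  refine Finset.sum_congr rfl fun i _ => Finset.sum_congr rfl fun j _ => ?_
  have := hd i
  have := hd j
  field_simp

theorem quadForm_correlation_inv {κ : Type*} [Fintype κ] [DecidableEq κ] {M : Matrix κ κ ℝ}
    (hM : M.PosDef) (x : κ → ℝ) :
    quadForm (correlation M)⁻¹ (fun j => x j / √(M j j)) = quadForm M⁻¹ x := by
  have hd : ∀ i, 0 < √(M i i) := fun i => Real.sqrt_pos.2 hM.diag_pos
  have hC : correlation M = Matrix.diagonal (fun i => (√(M i i))⁻¹) * M *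
      Matrix.diagonal (fun i => (√(M i i))⁻¹) := by
    ext i j
    rw [Matrix.mul_diagonal, Matrix.diagonal_mul, correlation, Matrix.of_apply]
    have := hd i
    have := hd j
    field_simp
  have hu : IsUnit (correlation M).det := by
    have h1 : ∏ i, (√(M i i))⁻¹ ≠ 0 := Finset.prod_ne_zero_iff.2 fun i _ => (inv_pos.2 (hd i)).ne'
    rw [hC, Matrix.det_mul, Matrix.det_mul, Matrix.det_diagonal]
    exact (h1.isUnit.mul (isUnit_det_of_posDef hM)).mul h1.isUnit
  have hx := mulVec_inv_mulVec (isUnit_det_of_posDef hM) x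
  set v := M⁻¹ *ᵥ x with hv
  have h : (correlation M)⁻¹ *ᵥ (fun j => x j / √(M j j)) = fun j => √(M j j) * v j := by
    refine inv_mulVec_of_mulVec_eq hu ?_
    funext i
    rw [← hx]
    simp only [Matrix.mulVec, dotProduct, correlation, Matrix.of_apply, Finset.sum_div]
    refine Finset.sum_congr rfl fun j _ => ?_
    have := hd i
    have := hd j
    field_simp
  rw [quadForm, h, quadForm, ← hv]
  simp only [dotProduct]
  refine Finset.sum_congr rfl fun j _ => ?_
  have := hd j
  field_simp

end

section

/-! ### One-dimensional primitives of extended nonnegative functions -/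

/-- Finiteness up to some `b` beyond `r` makes the real-valued primitive meaningful on a whole
neighbourhood of `r`. Continuity is asked at `r` only, because the integrands in use may be singular
when the moving coordinate is zero. -/
theorem hasDerivAt_toReal_lintegral_Iic {H : ℝ → ENNReal} (hH : Measurable H) {r b : ℝ}
    (hrb : r < b) (hfin : ∫⁻ t in Set.Iic b, H t ≠ ⊤) (hc : ContinuousAt H r) (hr : H r ≠ ⊤) :
    HasDerivAt (fun s => (∫⁻ t in Set.Iic s, H t).toReal) (H r).toReal r := by
  have hi : IntegrableOn (fun t => (H t).toReal) (Set.Iic b) :=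
    integrable_toReal_of_lintegral_ne_top hH.aemeasurable hfin
  have hae := ae_lt_top hH hfin
  have hrs : ∀ s ≤ b, IntegrableOn (fun t => (H t).toReal) (Set.Iic s) := fun s hs =>
    hi.mono_set (Set.Iic_subset_Iic.2 hs)
  have hint : IntervalIntegrable (fun t => (H t).toReal) volume r r := by simp
  have h := (intervalIntegral.integral_hasDerivAt_right hint
    hH.ennreal_toReal.stronglyMeasurable.stronglyMeasurableAtFilter
    ((ENNReal.tendsto_toReal hr).comp hc)).const_add (∫ t in Set.Iic r, (H t).toReal)
  refine h.congr_of_eventuallyEq ?_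
  filter_upwards [Iio_mem_nhds hrb] with s hs
  have hs' : s ≤ b := le_of_lt hs
  rw [← intervalIntegral.integral_Iic_sub_Iic (hrs r hrb.le) (hrs s hs'),
    integral_toReal hH.aemeasurable (ae_restrict_of_ae_restrict_of_subset
      (Set.Iic_subset_Iic.2 hs') hae)]
  ring

theorem hasDerivAt_toReal_lintegral_Ioi {H : ℝ → ENNReal} (hH : Measurable H) {r a : ℝ}
    (har : a < r) (hfin : ∫⁻ t in Set.Ioi a, H t ≠ ⊤) (hc : ContinuousAt H r) (hr : H r ≠ ⊤) :
    HasDerivAt (fun s => (∫⁻ t in Set.Ioi s, H t).toReal) (-(H r).toReal) r := by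
  have hi : IntegrableOn (fun t => (H t).toReal) (Set.Ioi a) :=
    integrable_toReal_of_lintegral_ne_top hH.aemeasurable hfin
  have hae := ae_lt_top hH hfin
  have hrs : ∀ s, a ≤ s → IntegrableOn (fun t => (H t).toReal) (Set.Ioi s) := fun s hs =>
    hi.mono_set (Set.Ioi_subset_Ioi hs)
  have hint : IntervalIntegrable (fun t => (H t).toReal) volume r r := by simp
  have h := (intervalIntegral.integral_hasDerivAt_right hint
    hH.ennreal_toReal.stronglyMeasurable.stronglyMeasurableAtFilter
    ((ENNReal.tendsto_toReal hr).comp hc)).const_sub (∫ t in Set.Ioi r, (H t).toReal)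
  refine h.congr_of_eventuallyEq ?_
  filter_upwards [Ioi_mem_nhds har] with s hs
  have hs' : a ≤ s := le_of_lt hs
  rw [← intervalIntegral.integral_Ioi_sub_Ioi' (hrs r har.le) (hrs s hs'),
    integral_toReal hH.aemeasurable (ae_restrict_of_ae_restrict_of_subset
      (Set.Ioi_subset_Ioi hs') hae)]
  ring

/-! ### Orthant integrals of a density with polynomial tails -/

variable {ι : Type*} [Fintype ι]

/-- A nonnegative function, continuous away from the origin, and dominated by `C ‖x‖ ^ (-r)`
with `r` larger than the dimension. -/
structure IsTailDensity (g : (ι → ℝ) → ℝ) (C r : ℝ) : Prop where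
  continuousAt : ∀ x ≠ 0, ContinuousAt g x
  nonneg : ∀ x, 0 ≤ g x
  le_rpow : ∀ x ≠ 0, g x ≤ C * ‖x‖ ^ (-r)
  card_lt : (Fintype.card ι : ℝ) < r

variable {g : (ι → ℝ) → ℝ} {C r : ℝ}

/-- The integral of `g` over the points that exceed `u` in some coordinate. -/
def exceedanceIntegral (g : (ι → ℝ) → ℝ) (u : ι → ℝ) : ENNReal :=
  ∫⁻ x in {x : ι → ℝ | ∃ i, u i < x i}, ENNReal.ofReal (g x)

theorem IsTailDensity.measurable (hg : IsTailDensity g C r) : Measurable g :=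
  measurable_of_continuousOn_compl_singleton 0 fun x hx => (hg.continuousAt x hx).continuousWithinAt

theorem IsTailDensity.exponent_pos (hg : IsTailDensity g C r) : 0 < r :=
  (Nat.cast_nonneg _).trans_lt hg.card_lt

/-- Off a ball around the origin the singular bound can be replaced by one that is integrable over
the whole space. The parameter `t` lets the decay be measured by the norm of some of the coordinates
only. The constant comes from `min δ 1 / 2 * (1 + t) ≤ ‖x‖`. -/
theorem IsTailDensity.le_one_add (hg : IsTailDensity g C r) {x : ι → ℝ} {δ t : ℝ} (hδ : 0 < δ)
    (hx : δ ≤ ‖x‖) (ht : 0 ≤ t) (htx : t ≤ ‖x‖) :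
    g x ≤ |C| * (min δ 1 / 2) ^ (-r) * (1 + t) ^ (-r) := by
  have hr := hg.exponent_pos
  have hx0 : x ≠ 0 := by
    rintro rfl
    simp at hx
    linarith
  have hm : 0 < min δ 1 := lt_min hδ one_pos
  have h : min δ 1 / 2 * (1 + t) ≤ ‖x‖ := by
    have h1 : min δ 1 ≤ δ := min_le_left _ _
    have h2 : min δ 1 * t ≤ t := mul_le_of_le_one_left ht (min_le_right _ _)
    linarith
  calc g x ≤ C * ‖x‖ ^ (-r) := hg.le_rpow x hx0
    _ ≤ |C| * ‖x‖ ^ (-r) := by gcongr; exact le_abs_self C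
    _ ≤ |C| * (min δ 1 / 2 * (1 + t)) ^ (-r) :=
      mul_le_mul_of_nonneg_left (Real.rpow_le_rpow_of_nonpos
        (mul_pos (half_pos hm) (by linarith)) h (by linarith)) (abs_nonneg C)
    _ = _ := by rw [Real.mul_rpow (by positivity) (by positivity), mul_assoc]

theorem lintegral_const_mul_one_add_norm_ne_top {κ : Type*} [Fintype κ] {r : ℝ}
    (hr : (Fintype.card κ : ℝ) < r) (c : ℝ) (s : Set (κ → ℝ)) :
    ∫⁻ y in s, ENNReal.ofReal (c * (1 + ‖y‖) ^ (-r)) ≠ ⊤ := by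
  refine ne_top_of_le_ne_top ?_ (setLIntegral_le_lintegral s _)
  simp_rw [ENNReal.ofReal_mul' (Real.rpow_nonneg (add_nonneg zero_le_one (norm_nonneg _)) (-r))]
  rw [lintegral_const_mul' _ _ ENNReal.ofReal_ne_top]
  refine ENNReal.mul_ne_top ENNReal.ofReal_ne_top (finite_integral_one_add_norm ?_).ne
  simpa using hr

theorem norm_restr_le (A : Finset ι) (x : ι → ℝ) : ‖restr A x‖ ≤ ‖x‖ :=
  (pi_norm_le_iff_of_nonneg (norm_nonneg x)).2 fun i => norm_le_pi_norm x i

theorem exceedanceIntegral_ne_top (hg : IsTailDensity g C r) [Nonempty ι] {u : ι → ℝ}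
    (hu : ∀ i, 0 < u i) : exceedanceIntegral g u ≠ ⊤ := by
  obtain ⟨i₀, hi₀⟩ := Finite.exists_min u
  rw [exceedanceIntegral]
  refine ne_top_of_le_ne_top (lintegral_const_mul_one_add_norm_ne_top hg.card_lt
    (|C| * (min (u i₀) 1 / 2) ^ (-r)) {x : ι → ℝ | ∃ i, u i < x i})
    (setLIntegral_mono' ?_ fun x hx => ENNReal.ofReal_le_ofReal ?_)
  · simp only [Set.ofPred_exists]
    exact MeasurableSet.iUnion fun i => measurableSet_lt measurable_const (measurable_pi_apply i)
  · obtain ⟨i, hi⟩ := hx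
    refine hg.le_one_add (hu i₀) ?_ (norm_nonneg _) le_rfl
    exact (hi₀ i).trans (hi.le.trans ((le_abs_self _).trans (norm_le_pi_norm x i)))

/-! ### Faces of orthants: freezing coordinates, finiteness and differentiation -/

variable [DecidableEq ι]

/-- The integral of `g` over the coordinates outside `A`, below `u`, with the coordinates in `A`
fixed to those of `u`. -/
def orthantIntegral (g : (ι → ℝ) → ℝ) (A : Finset ι) (u : ι → ℝ) : ENNReal :=
  (∫⋯∫⁻_Aᶜ, (fun x => ENNReal.ofReal (g x)) ∂(fun i => volume.restrict (Set.Iic (u i)))) u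

/-- The iterated form in the definition suits integrating out one coordinate; this form suits
domination and is the one that matches the skew-`t` cdf. -/
theorem orthantIntegral_eq (g : (ι → ℝ) → ℝ) (A : Finset ι) (u : ι → ℝ) :
    orthantIntegral g A u =
      ∫⁻ y in Set.Iic (restr Aᶜ u), ENNReal.ofReal (g (glue A (restr A u) y)) := by
  rw [orthantIntegral, lmarginal]
  have h1 : (Measure.pi fun i : (Aᶜ : Finset ι) => volume.restrict (Set.Iic (u i))) =
      volume.restrict (Set.Iic (restr Aᶜ u)) := by
    rw [← Measure.restrict_pi_pi, Set.pi_univ_Iic]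
    rfl
  have h2 : ∀ y : (Aᶜ : Finset ι) → ℝ, Function.updateFinset u Aᶜ y = glue A (restr A u) y := by
    intro y
    funext i
    by_cases hi : i ∈ A <;> simp [Function.updateFinset, glue, restr, hi]
  simp_rw [h2]
  rw [h1]

/-- One frozen coordinate bounded below by `δ` keeps the whole face away from the origin. -/
theorem IsTailDensity.glue_le (hg : IsTailDensity g C r) {A : Finset ι} {a : A → ℝ} {i : A}
    {δ : ℝ} (hδ : 0 < δ) (ha : δ ≤ a i) (y : (Aᶜ : Finset ι) → ℝ) :
    g (glue A a y) ≤ |C| * (min δ 1 / 2) ^ (-r) * (1 + ‖y‖) ^ (-r) := by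
  refine hg.le_one_add hδ ?_ (norm_nonneg _) ?_
  · have h := norm_le_pi_norm (glue A a y) i
    have h2 : glue A a y i = a i := by simp [glue]
    rw [h2] at h
    exact ha.trans ((le_abs_self _).trans h)
  · have h := norm_restr_le Aᶜ (glue A a y)
    rwa [restr_compl_glue] at h

theorem IsTailDensity.card_compl_lt (hg : IsTailDensity g C r) (A : Finset ι) :
    (Fintype.card (Aᶜ : Finset ι) : ℝ) < r := by
  refine lt_of_le_of_lt ?_ hg.card_lt
  rw [Fintype.card_coe]
  exact_mod_cast Finset.card_le_univ _

theorem orthantIntegral_ne_top (hg : IsTailDensity g C r) {A : Finset ι} {u : ι → ℝ} {i : ι}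
    (hi : i ∈ A) (hu : 0 < u i) : orthantIntegral g A u ≠ ⊤ := by
  rw [orthantIntegral_eq]
  refine ne_top_of_le_ne_top (lintegral_const_mul_one_add_norm_ne_top (hg.card_compl_lt A) _ _)
    (lintegral_mono fun y => ENNReal.ofReal_le_ofReal
      (hg.glue_le (i := ⟨i, hi⟩) hu le_rfl y))

theorem continuousAt_orthantIntegral (hg : IsTailDensity g C r) {A : Finset ι} (u : ι → ℝ)
    {j : ι} (hj : j ∈ A) {t₀ : ℝ} (ht₀ : 0 < t₀) :
    ContinuousAt (fun t => orthantIntegral g A (Function.update u j t)) t₀ := by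
  have hr : ∀ t, restr Aᶜ (Function.update u j t) = restr Aᶜ u := by
    intro t
    funext i
    have : (i : ι) ≠ j := fun h => Finset.mem_compl.1 i.2 (h ▸ hj)
    simp [restr, this]
  simp_rw [orthantIntegral_eq, hr]
  have hglue : ∀ y : (Aᶜ : Finset ι) → ℝ,
      Continuous fun t => glue A (restr A (Function.update u j t)) y := by
    intro y
    refine continuous_pi fun i => ?_
    by_cases hi : i ∈ A
    · simp only [glue, hi, dif_pos, restr]
      fun_prop
    · simp only [glue, hi, dif_neg, not_false_iff]
      fun_prop
  have hglue' : ∀ t, Measurable fun y : (Aᶜ : Finset ι) → ℝ =>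
      glue A (restr A (Function.update u j t)) y := by
    intro t
    refine measurable_pi_lambda _ fun i => ?_
    by_cases hi : i ∈ A
    · simp only [glue, hi, dif_pos]
      fun_prop
    · simp only [glue, hi, dif_neg, not_false_iff]
      fun_prop
  refine tendsto_lintegral_filter_of_dominated_convergence
    (fun y => ENNReal.ofReal (|C| * (min (t₀ / 2) 1 / 2) ^ (-r) * (1 + ‖y‖) ^ (-r))) ?_ ?_
    (lintegral_const_mul_one_add_norm_ne_top (hg.card_compl_lt A) _ _) ?_
  · exact Filter.Eventually.of_forall fun t => (hg.measurable.comp (hglue' t)).ennreal_ofReal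
  -- Restricting to `t > t₀ / 2` gives a dominating function independent of `t`.
  · filter_upwards [Ioi_mem_nhds (half_lt_self ht₀)] with t ht
    refine ae_of_all _ fun y => ENNReal.ofReal_le_ofReal ?_
    refine hg.glue_le (i := ⟨j, hj⟩) (half_pos ht₀) ?_ y
    simpa [restr] using le_of_lt ht
  · refine ae_of_all _ fun y => (ENNReal.continuous_ofReal.tendsto _).comp ?_
    refine ContinuousAt.comp (g := g) (hg.continuousAt _ fun h => ?_) (hglue y).continuousAt
    have := congrFun h j
    simp [glue, hj, restr] at this
    exact ht₀.ne' this

theorem measurable_orthantIntegral_update (hg : IsTailDensity g C r) {A : Finset ι} (u : ι → ℝ)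
    {j : ι} (hj : j ∈ A) :
    Measurable fun t => orthantIntegral g A (Function.update u j t) := by
  -- Since `j ∈ A`, the upper limits do not involve coordinate `j`; with the measures held fixed,
  -- the map is a measurable marginal composed with `Function.update`.
  have h : (fun t => orthantIntegral g A (Function.update u j t)) = fun t =>
      (∫⋯∫⁻_Aᶜ, (fun x => ENNReal.ofReal (g x)) ∂(fun i => volume.restrict (Set.Iic (u i))))
        (Function.update u j t) := by
    funext t
    have : ∀ i : (Aᶜ : Finset ι), Function.update u j t i = u i := by
      intro i
      have hij : (i : ι) ≠ j := fun h => Finset.mem_compl.1 i.2 (h ▸ hj)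
      exact Function.update_of_ne hij _ _
    simp only [orthantIntegral, lmarginal, this]
  rw [h]
  exact (hg.measurable.ennreal_ofReal.lmarginal _).comp (measurable_update u)

theorem orthantIntegral_eq_lintegral_insert (hg : IsTailDensity g C r) {A : Finset ι} (u : ι → ℝ)
    {j : ι} (hj : j ∉ A) :
    orthantIntegral g A u =
      ∫⁻ t in Set.Iic (u j), orthantIntegral g (insert j A) (Function.update u j t) := by
  rw [orthantIntegral, lmarginal_erase _ hg.measurable.ennreal_ofReal (Finset.mem_compl.2 hj)]
  refine lintegral_congr fun t => ?_
  rw [← Finset.compl_insert]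
  have : ∀ i : ((insert j A)ᶜ : Finset ι), Function.update u j t i = u i := by
    intro i
    have hij : (i : ι) ≠ j := fun h =>
      Finset.mem_compl.1 i.2 (by rw [h]; exact Finset.mem_insert_self j A)
    exact Function.update_of_ne hij _ _
  simp only [orthantIntegral, lmarginal, this]

/-- The primitive runs over all `s ≤ t`, including `s = 0`. A coordinate already frozen at a
positive value is what keeps it finite, hence the nonemptiness of `A`. -/
theorem hasDerivAt_orthantIntegral (hg : IsTailDensity g C r) {A : Finset ι} (u : ι → ℝ)
    (hu : ∀ i, 0 < u i) (hA : A.Nonempty) {j : ι} (hj : j ∉ A) {t₀ : ℝ} (ht₀ : 0 < t₀) :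
    HasDerivAt (fun t => (orthantIntegral g A (Function.update u j t)).toReal)
      (orthantIntegral g (insert j A) (Function.update u j t₀)).toReal t₀ := by
  obtain ⟨i, hi⟩ := hA
  have hij : i ≠ j := fun h => hj (h ▸ hi)
  have h1 : ∀ t, orthantIntegral g A (Function.update u j t) =
      ∫⁻ s in Set.Iic t, orthantIntegral g (insert j A) (Function.update u j s) := by
    intro t
    rw [orthantIntegral_eq_lintegral_insert hg _ hj]
    simp
  simp_rw [h1]
  have hjA := Finset.mem_insert_self j A
  refine hasDerivAt_toReal_lintegral_Iic (measurable_orthantIntegral_update hg u hjA)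
    (lt_add_one t₀) ?_ (continuousAt_orthantIntegral hg u hjA ht₀)
    (orthantIntegral_ne_top hg hjA (by simpa))
  rw [← h1]
  refine orthantIntegral_ne_top hg hi ?_
  rw [Function.update_of_ne hij]
  exact hu i

/-- Points exceeding in some coordinate other than `j` do not see the threshold `t`. The others
exceed in coordinate `j` alone; slicing them at `x j = s` gives faces, and the threshold becomes the
lower limit, whence the minus sign of the first derivative. -/
theorem exceedanceIntegral_update (hg : IsTailDensity g C r) (u : ι → ℝ) (j : ι) (t : ℝ) :
    exceedanceIntegral g (Function.update u j t) =
      (∫⁻ x in {x : ι → ℝ | ∃ i, i ≠ j ∧ u i < x i}, ENNReal.ofReal (g x)) +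
        ∫⁻ s in Set.Ioi t, orthantIntegral g {j} (Function.update u j s) := by
  set S : Set (ι → ℝ) := Set.univ.pi (Function.update (fun i => Set.Iic (u i)) j (Set.Ioi t))
    with hS
  have hmem : ∀ x, x ∈ S ↔ (∀ i ≠ j, x i ≤ u i) ∧ t < x j := by
    intro x
    rw [hS, Set.mem_univ_pi]
    constructor
    · intro h
      refine ⟨fun i hi => ?_, ?_⟩
      · simpa [hi] using h i
      · simpa using h j
    · rintro ⟨h1, h2⟩ i
      by_cases hi : i = j
      · subst hi
        simpa using h2
      · simpa [hi] using h1 i hi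
  have hSm : MeasurableSet S := by
    refine MeasurableSet.univ_pi fun i => ?_
    by_cases hi : i = j
    · subst hi
      simp
    · simp [hi]
  have hset : {x : ι → ℝ | ∃ i, Function.update u j t i < x i} =
      {x : ι → ℝ | ∃ i, i ≠ j ∧ u i < x i} ∪ S := by
    ext x
    simp only [Set.mem_ofPred_eq, Set.mem_union, hmem]
    constructor
    · rintro ⟨i, hi⟩
      by_cases h : ∃ i, i ≠ j ∧ u i < x i
      · exact Or.inl h
      · push Not at h
        by_cases hij : i = j
        · subst hij
          exact Or.inr ⟨h, by simpa using hi⟩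
        · rw [Function.update_of_ne hij] at hi
          exact absurd hi (not_lt.2 (h i hij))
    · rintro (⟨i, hij, hi⟩ | ⟨-, h⟩)
      · exact ⟨i, by simpa [hij] using hi⟩
      · exact ⟨j, by simpa using h⟩
  have hdisj : Disjoint {x : ι → ℝ | ∃ i, i ≠ j ∧ u i < x i} S := by
    rw [Set.disjoint_left]
    rintro x ⟨i, hij, hi⟩ hx
    exact absurd hi (not_lt.2 (((hmem x).1 hx).1 i hij))
  rw [exceedanceIntegral, hset, lintegral_union hSm hdisj]
  congr 1
  rw [hS, volume_pi, Measure.restrict_pi_pi, lintegral_eq_lmarginal_univ u,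
    lmarginal_erase _ hg.measurable.ennreal_ofReal (Finset.mem_univ j)]
  simp only [Function.update_self]
  refine lintegral_congr fun s => ?_
  rw [← Finset.compl_singleton, orthantIntegral, lmarginal, lmarginal]
  have : ∀ i : (({j} : Finset ι)ᶜ : Finset ι), (i : ι) ≠ j := fun i h =>
    Finset.mem_compl.1 i.2 (by simp [h])
  congr 2
  funext i
  rw [Function.update_of_ne (this i), Function.update_of_ne (this i)]

theorem hasDerivAt_exceedanceIntegral (hg : IsTailDensity g C r) (u : ι → ℝ)
    (hu : ∀ i, 0 < u i) (j : ι) {t₀ : ℝ} (ht₀ : 0 < t₀) :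
    HasDerivAt (fun t => (exceedanceIntegral g (Function.update u j t)).toReal)
      (-(orthantIntegral g {j} (Function.update u j t₀)).toReal) t₀ := by
  have : Nonempty ι := ⟨j⟩
  have hj : j ∈ ({j} : Finset ι) := Finset.mem_singleton_self j
  have hfin : ∀ t, 0 < t → exceedanceIntegral g (Function.update u j t) ≠ ⊤ := by
    intro t ht
    refine exceedanceIntegral_ne_top hg fun i => ?_
    by_cases hi : i = j
    · subst hi
      simpa using ht
    · simpa [hi] using hu i
  have hsum : ∀ t, 0 < t →
      (∫⁻ x in {x : ι → ℝ | ∃ i, i ≠ j ∧ u i < x i}, ENNReal.ofReal (g x)) ≠ ⊤ ∧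
        ∫⁻ s in Set.Ioi t, orthantIntegral g {j} (Function.update u j s) ≠ ⊤ := by
    intro t ht
    have := hfin t ht
    rw [exceedanceIntegral_update hg] at this
    exact ENNReal.add_ne_top.1 this
  have h := (hasDerivAt_toReal_lintegral_Ioi (measurable_orthantIntegral_update hg u hj)
    (half_lt_self ht₀) (hsum _ (half_pos ht₀)).2 (continuousAt_orthantIntegral hg u hj ht₀)
    (orthantIntegral_ne_top hg hj (by simpa))).const_add
      (∫⁻ x in {x : ι → ℝ | ∃ i, i ≠ j ∧ u i < x i}, ENNReal.ofReal (g x)).toReal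
  refine h.congr_of_eventuallyEq ?_
  filter_upwards [Ioi_mem_nhds ht₀] with t ht
  rw [exceedanceIntegral_update hg, ENNReal.toReal_add (hsum t ht).1 (hsum t ht).2]

end

/-! ### The exponent measure -/

section
variable {ι : Type*} [Fintype ι] [DecidableEq ι]

/-- The density of the exponent measure: the closed form of
`∫ s in (0, ∞), ν s ^ (ν + d - 1) f (s x)`, with `f` the extended skew-normal density. -/
def exponentDensity (Ω : Matrix ι ι ℝ) (α : ι → ℝ) (τ ν : ℝ) (x : ι → ℝ) : ℝ :=
  ν * (√((2 * Real.pi) ^ Fintype.card ι * Ω.det))⁻¹ / stdNormalCDF (τ / √(1 + quadForm Ω α)) *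
    (2 ^ ((ν + Fintype.card ι) / 2 - 1) * Real.Gamma ((ν + Fintype.card ι) / 2) *
      quadForm Ω⁻¹ x ^ (-((ν + Fintype.card ι) / 2)) *
      noncentralTCDF (α ⬝ᵥ x / √(quadForm Ω⁻¹ x) * √(ν + Fintype.card ι)) (-τ)
        (ν + Fintype.card ι))

theorem continuous_quadForm {κ : Type*} [Fintype κ] (M : Matrix κ κ ℝ) : Continuous (quadForm M) := by
  unfold quadForm dotProduct Matrix.mulVec dotProduct
  fun_prop

theorem continuous_extSkewNormalDensity (Ω : Matrix ι ι ℝ) (α : ι → ℝ) (τ : ℝ) :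
    Continuous (extSkewNormalDensity Ω α τ) := by
  have h1 := continuous_quadForm Ω⁻¹
  have h2 : Continuous fun w => stdNormalCDF (α ⬝ᵥ w + τ) :=
    stdNormalCDF_continuous.comp (by unfold dotProduct; fun_prop)
  unfold extSkewNormalDensity gaussianDensity
  fun_prop

theorem quadForm_smul {κ : Type*} [Fintype κ] (M : Matrix κ κ ℝ) (s : ℝ) (x : κ → ℝ) :
    quadForm M (s • x) = s ^ 2 * quadForm M x := by
  simp only [quadForm, Matrix.mulVec_smul, dotProduct_smul, smul_dotProduct, smul_eq_mul]
  ring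

variable {Ω : Matrix ι ι ℝ} {α : ι → ℝ} {τ ν : ℝ}

/-- Along the ray through `x` the density is a Gaussian in `s` times `Φ` of an affine function of
`s`, which is the integrand of `lintegral_ray_eq`. -/
theorem lintegral_ray_extSkewNormalDensity (hν : 0 < ν) (hΩ : Ω.PosDef) {x : ι → ℝ}
    (hx : x ≠ 0) :
    ∫⁻ s in Set.Ioi (0 : ℝ), ENNReal.ofReal (ν * s ^ (ν + Fintype.card ι - 1)) *
        ENNReal.ofReal (extSkewNormalDensity Ω α τ (s • x)) =
      ENNReal.ofReal (exponentDensity Ω α τ ν x) := by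
  have hn : 0 < ν + Fintype.card ι := by positivity
  have h0 := stdNormalCDF_pos (τ / √(1 + quadForm Ω α))
  rw [exponentDensity, ENNReal.ofReal_mul (by positivity),
    ← lintegral_ray_eq hn (quadForm_pos hΩ.inv hx), ← lintegral_const_mul' _ _ ENNReal.ofReal_ne_top]
  refine setLIntegral_congr_fun measurableSet_Ioi fun s hs => ?_
  have hs' : 0 < s := hs
  rw [← ENNReal.ofReal_mul (by positivity), ← ENNReal.ofReal_mul (by positivity)]
  congr 1
  rw [extSkewNormalDensity, gaussianDensity, quadForm_smul, dotProduct_smul, smul_eq_mul]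
  ring

theorem exponentDensity_pos (hν : 0 < ν) (hΩ : Ω.PosDef) {x : ι → ℝ} (hx : x ≠ 0) :
    0 < exponentDensity Ω α τ ν x := by
  have hn : 0 < ν + Fintype.card ι := by positivity
  have h0 := stdNormalCDF_pos (τ / √(1 + quadForm Ω α))
  have h1 := quadForm_pos hΩ.inv hx
  have h2 := noncentralTCDF_pos hn (α ⬝ᵥ x / √(quadForm Ω⁻¹ x) * √(ν + Fintype.card ι)) (-τ)
  have h3 := hΩ.det_pos
  have h4 : 0 < Real.Gamma ((ν + Fintype.card ι) / 2) := Real.Gamma_pos_of_pos (by positivity)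
  unfold exponentDensity
  positivity

theorem isTailDensity_exponentDensity (hν : 0 < ν) (hΩ : Ω.PosDef) (hdiag : ∀ i, Ω i i = 1) :
    IsTailDensity (exponentDensity Ω α τ ν)
      (ν * (√((2 * Real.pi) ^ Fintype.card ι * Ω.det))⁻¹ /
        stdNormalCDF (τ / √(1 + quadForm Ω α)) *
        (2 ^ ((ν + Fintype.card ι) / 2 - 1) * Real.Gamma ((ν + Fintype.card ι) / 2)))
      (ν + Fintype.card ι) := by
  have hn : 0 < ν + Fintype.card ι := by positivity
  have h0 := stdNormalCDF_pos (τ / √(1 + quadForm Ω α))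
  have h4 : 0 < Real.Gamma ((ν + Fintype.card ι) / 2) := Real.Gamma_pos_of_pos (by positivity)
  refine ⟨fun x hx => ?_, fun x => ?_, fun x hx => ?_, by linarith⟩
  · have h1 := quadForm_pos hΩ.inv hx
    have hq := (continuous_quadForm Ω⁻¹).continuousAt (x := x)
    have hd : ContinuousAt (fun x => α ⬝ᵥ x) x :=
      (show Continuous fun x => α ⬝ᵥ x by unfold dotProduct; fun_prop).continuousAt
    have ht := (noncentralTCDF_continuous hn (-τ)).continuousAt.comp
      (x := x) (f := fun x => α ⬝ᵥ x / √(quadForm Ω⁻¹ x) * √(ν + Fintype.card ι))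
      ((hd.div hq.sqrt (Real.sqrt_ne_zero'.2 h1)).mul_const _)
    exact continuousAt_const.mul ((continuousAt_const.mul
      (hq.rpow_const (Or.inl h1.ne'))).mul ht)
  · have h1 := quadForm_nonneg hΩ.inv x
    have h2 := noncentralTCDF_nonneg (α ⬝ᵥ x / √(quadForm Ω⁻¹ x) * √(ν + Fintype.card ι)) (-τ)
      (ν + Fintype.card ι)
    unfold exponentDensity
    positivity
  · have h1 := norm_sq_le_quadForm_inv hΩ hdiag x
    have hx' : 0 < ‖x‖ := norm_pos_iff.2 hx
    have h2 : quadForm Ω⁻¹ x ^ (-((ν + Fintype.card ι) / 2)) ≤ ‖x‖ ^ (-(ν + Fintype.card ι)) := by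
      calc _ ≤ (‖x‖ ^ 2) ^ (-((ν + Fintype.card ι) / 2)) :=
            Real.rpow_le_rpow_of_nonpos (by positivity) h1 (by linarith)
        _ = _ := by
          rw [← Real.rpow_natCast, ← Real.rpow_mul hx'.le]
          congr 1
          push_cast
          ring
    have h3 := noncentralTCDF_le_one hn
      (α ⬝ᵥ x / √(quadForm Ω⁻¹ x) * √(ν + Fintype.card ι)) (-τ)
    rw [exponentDensity, mul_assoc (ν * _ / _)]
    refine mul_le_mul_of_nonneg_left ?_ (by positivity)
    rw [mul_assoc (2 ^ _ * _)]
    refine mul_le_mul_of_nonneg_left ?_ (by positivity)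
    calc _ ≤ quadForm Ω⁻¹ x ^ (-((ν + Fintype.card ι) / 2)) * 1 :=
          mul_le_mul_of_nonneg_left h3 (Real.rpow_nonneg (quadForm_nonneg hΩ.inv x) _)
      _ ≤ _ := by rwa [mul_one]

theorem lintegral_eq_lintegral_smul {κ : Type*} [Fintype κ] {t : ℝ} (ht : 0 < t) {F : (κ → ℝ) → ENNReal}
    (hF : Measurable F) :
    ∫⁻ w, F w = ENNReal.ofReal (t ^ Fintype.card κ) * ∫⁻ x, F (t • x) := by
  have h := Measure.map_addHaar_smul (volume : Measure (κ → ℝ)) ht.ne'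
  have h2 : ∫⁻ x, F (t • x) = ENNReal.ofReal (t ^ Fintype.card κ)⁻¹ * ∫⁻ w, F w := by
    rw [← lintegral_map hF (measurable_const_smul t), h, lintegral_smul_measure]
    rw [abs_of_pos (by positivity), Module.finrank_fintype_fun_eq_card]
    rfl
  rw [h2, ← mul_assoc, ← ENNReal.ofReal_mul (by positivity), mul_inv_cancel₀ (by positivity)]
  simp

/-- Layer cake gives the weight `ν t ^ (ν - 1)`; by homogeneity the substitution `w = t x` maps `{M
> t}` to the fixed set `{M > 1}` with Jacobian `t ^ d`. Tonelli then leaves a ray integral for each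
`x`. -/
theorem lintegral_rpow_extSkewNormal (hν : 0 < ν) (hΩ : Ω.PosDef) {M : (ι → ℝ) → ℝ}
    (hM : Measurable M) (hM0 : ∀ x, 0 ≤ M x) (hMs : ∀ t > 0, ∀ x, M (t • x) = t * M x) :
    ∫⁻ w, ENNReal.ofReal (M w ^ ν) ∂(extSkewNormal Ω α τ) =
      ∫⁻ x in {x | 1 < M x}, ENNReal.ofReal (exponentDensity Ω α τ ν x) := by
  have hf := (continuous_extSkewNormalDensity Ω α τ).measurable
  have hS : MeasurableSet {x | 1 < M x} := measurableSet_lt measurable_const hM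
  -- This excludes the origin from `{M > 1}`; the closed form of the ray integral fails there.
  have hM00 : M 0 = 0 := by
    have := hMs 2 two_pos 0
    rw [smul_zero] at this
    linarith
  have hmeas : ∀ t > 0, extSkewNormal Ω α τ {w | t < M w} = ENNReal.ofReal (t ^ Fintype.card ι) *
      ∫⁻ x in {x | 1 < M x}, ENNReal.ofReal (extSkewNormalDensity Ω α τ (t • x)) := by
    intro t ht
    have hSt : MeasurableSet {x | t < M x} := measurableSet_lt measurable_const hM
    rw [extSkewNormal, withDensity_apply _ hSt, ← lintegral_indicator hSt,
      lintegral_eq_lintegral_smul ht (hf.ennreal_ofReal.indicator hSt), ← lintegral_indicator hS]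
    congr 2
    funext x
    have : t • x ∈ {x | t < M x} ↔ x ∈ {x | 1 < M x} := by
      simp only [Set.mem_ofPred_eq, hMs t ht]
      constructor <;> intro h
      · by_contra hc
        nlinarith
      · nlinarith
    by_cases hx : x ∈ {x | 1 < M x}
    · rw [Set.indicator_of_mem hx, Set.indicator_of_mem (this.2 hx)]
    · rw [Set.indicator_of_notMem hx, Set.indicator_of_notMem (mt this.1 hx)]
  have hjoint : Measurable fun p : ℝ × (ι → ℝ) =>
      ENNReal.ofReal (ν * p.1 ^ (ν + Fintype.card ι - 1)) *
        ENNReal.ofReal (extSkewNormalDensity Ω α τ (p.1 • p.2)) := by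
    have : Measurable fun p : ℝ × (ι → ℝ) => extSkewNormalDensity Ω α τ (p.1 • p.2) :=
      hf.comp (by fun_prop)
    fun_prop
  calc ∫⁻ w, ENNReal.ofReal (M w ^ ν) ∂(extSkewNormal Ω α τ)
      = ENNReal.ofReal ν * ∫⁻ t in Set.Ioi 0,
          extSkewNormal Ω α τ {w | t < M w} * ENNReal.ofReal (t ^ (ν - 1)) :=
        lintegral_rpow_eq_lintegral_meas_lt_mul _ (ae_of_all _ hM0) hM.aemeasurable hν
    _ = ∫⁻ t in Set.Ioi (0 : ℝ), ∫⁻ x in {x | 1 < M x},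
          ENNReal.ofReal (ν * t ^ (ν + Fintype.card ι - 1)) *
            ENNReal.ofReal (extSkewNormalDensity Ω α τ (t • x)) := by
        rw [← lintegral_const_mul' _ _ ENNReal.ofReal_ne_top]
        refine setLIntegral_congr_fun measurableSet_Ioi fun t ht => ?_
        have ht' : 0 < t := ht
        rw [hmeas t ht', lintegral_const_mul' _ _ ENNReal.ofReal_ne_top, mul_right_comm,
          ← mul_assoc, ← ENNReal.ofReal_mul (by positivity), ← ENNReal.ofReal_mul (by positivity)]
        congr 3
        rw [← Real.rpow_natCast, ← Real.rpow_add ht']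
        congr 1
        ring_nf
    _ = ∫⁻ x in {x | 1 < M x}, ∫⁻ t in Set.Ioi (0 : ℝ),
          ENNReal.ofReal (ν * t ^ (ν + Fintype.card ι - 1)) *
            ENNReal.ofReal (extSkewNormalDensity Ω α τ (t • x)) :=
        lintegral_lintegral_swap hjoint.aemeasurable
    _ = _ := by
        refine setLIntegral_congr_fun hS fun x hx => ?_
        refine lintegral_ray_extSkewNormalDensity hν hΩ ?_
        rintro rfl
        simp only [Set.mem_ofPred_eq, hM00] at hx
        linarith

/-! ### Moments and the exponent function -/

variable {E : Type*} [MeasurableSpace E] {P : Measure E} {W : E → ι → ℝ}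

theorem integral_comp_extSkewNormal (hW : HasLaw W (extSkewNormal Ω α τ) P)
    {F : (ι → ℝ) → ℝ} (hF : Measurable F) (hF0 : ∀ w, 0 ≤ F w) :
    ∫ ω, F (W ω) ∂P = (∫⁻ w, ENNReal.ofReal (F w) ∂(extSkewNormal Ω α τ)).toReal := by
  have := hW.integral_comp (f := F) hF.aestronglyMeasurable
  simp only [Function.comp_def] at this
  rw [this, integral_eq_lintegral_of_nonneg_ae (ae_of_all _ hF0) hF.aestronglyMeasurable]

/-- The moment is the exponent measure of the half-space `{x i > 1}`: positive because that set is
open and nonempty and the density is positive on it, finite because the half-space stays away from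
the origin. -/
theorem plusMoment_pos (hν : 0 < ν) (hΩ : Ω.PosDef) (hdiag : ∀ i, Ω i i = 1)
    (hW : HasLaw W (extSkewNormal Ω α τ) P) (i : ι) : 0 < plusMoment P W ν i := by
  have : Nonempty ι := ⟨i⟩
  have hg := isTailDensity_exponentDensity (α := α) (τ := τ) hν hΩ hdiag
  have hM : Measurable fun w : ι → ℝ => max (w i) 0 := by fun_prop
  have hset : {x : ι → ℝ | 1 < max (x i) 0} = {x | 1 < x i} := by
    ext x
    simp [not_lt.2 zero_le_one]
  rw [plusMoment, integral_comp_extSkewNormal hW (F := fun w => max (w i) 0 ^ ν) (by fun_prop)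
    (fun w => by positivity), lintegral_rpow_extSkewNormal hν hΩ hM (fun x => le_max_right _ _)
    (fun t ht x => by
      rw [Pi.smul_apply, smul_eq_mul, mul_max_of_nonneg _ _ ht.le, mul_zero]), hset]
  have hopen : IsOpen {x : ι → ℝ | 1 < x i} := isOpen_lt continuous_const (continuous_apply i)
  refine ENNReal.toReal_pos ?_ (ne_top_of_le_ne_top
    (exceedanceIntegral_ne_top hg (u := fun _ => 1) fun _ => one_pos)
    (lintegral_mono_set fun x hx => ⟨i, hx⟩))
  rw [← pos_iff_ne_zero, setLIntegral_pos_iff hg.measurable.ennreal_ofReal]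
  have hsub : {x : ι → ℝ | 1 < x i} ⊆
      (Function.support fun x => ENNReal.ofReal (exponentDensity Ω α τ ν x)) ∩ {x | 1 < x i} := by
    intro x hx
    refine ⟨?_, hx⟩
    have hx0 : x ≠ 0 := by
      rintro rfl
      simp at hx
      linarith
    simpa using exponentDensity_pos hν hΩ hx0
  exact (hopen.measure_pos volume ⟨fun _ => 2, by simp⟩).trans_le (measure_mono hsub)

theorem ciSup_rpow {κ : Type*} [Finite κ] [Nonempty κ] {f : κ → ℝ} {ν : ℝ}
    (hf : ∀ i, 0 ≤ f i) (hν : 0 ≤ ν) :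
    (⨆ i, f i) ^ ν = ⨆ i, f i ^ ν := by
  obtain ⟨i, hi⟩ := exists_eq_ciSup_of_finite (f := f)
  refine le_antisymm ?_ (ciSup_le fun j => ?_)
  · rw [← hi]
    exact le_ciSup (f := fun i => f i ^ ν) (Set.finite_range _).bddAbove i
  · exact Real.rpow_le_rpow (hf j) (le_ciSup (Set.finite_range _).bddAbove j) hν

theorem circ_pos {κ : Type*} {ν : ℝ} {mp z : κ → ℝ} (hmp : ∀ i, 0 < mp i) (hz : ∀ i, 0 < z i) (i : κ) :
    0 < circ ν mp z i := Real.rpow_pos_of_pos (mul_pos (hz i) (hmp i)) _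

theorem exponentFunction_eq [Nonempty ι] (hν : 0 < ν) (hΩ : Ω.PosDef) (hdiag : ∀ i, Ω i i = 1)
    (hW : HasLaw W (extSkewNormal Ω α τ) P) {z : ι → ℝ} (hz : ∀ i, 0 < z i) :
    exponentFunction P W ν z =
      (exceedanceIntegral (exponentDensity Ω α τ ν) (circ ν (plusMoment P W ν) z)).toReal := by
  have hmp := plusMoment_pos hν hΩ hdiag hW
  set u := circ ν (plusMoment P W ν) z with hu
  have hu0 : ∀ i, 0 < u i := circ_pos hmp hz
  have hrpow : ∀ i, u i ^ ν = z i * plusMoment P W ν i := by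
    intro i
    rw [hu, circ, ← Real.rpow_mul (mul_pos (hz i) (hmp i)).le, one_div_mul_cancel hν.ne',
      Real.rpow_one]
  -- Pulling the power out of the maximum exposes a function homogeneous of degree one.
  have h1 : ∀ w : ι → ℝ, ⨆ i, max (w i) 0 ^ ν / (z i * plusMoment P W ν i) =
      (⨆ i, max (w i) 0 / u i) ^ ν := by
    intro w
    rw [ciSup_rpow (fun i => div_nonneg (le_max_right _ _) (hu0 i).le) hν.le]
    congr 1
    funext i
    rw [Real.div_rpow (le_max_right _ _) (hu0 i).le, hrpow]
  have hM : Measurable fun w : ι → ℝ => ⨆ i, max (w i) 0 / u i :=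
    Measurable.iSup fun i => by fun_prop
  have hM0 : ∀ w : ι → ℝ, 0 ≤ ⨆ i, max (w i) 0 / u i := fun w =>
    Real.iSup_nonneg fun i => div_nonneg (le_max_right _ _) (hu0 i).le
  simp only [exponentFunction, h1]
  rw [integral_comp_extSkewNormal hW (F := fun w => (⨆ i, max (w i) 0 / u i) ^ ν)
    (hM.pow_const ν) (fun w => Real.rpow_nonneg (hM0 w) _),
    lintegral_rpow_extSkewNormal hν hΩ hM hM0, exceedanceIntegral]
  · congr 3
    ext x
    simp only [Set.mem_ofPred_eq]
    have hlt : ∀ i, 1 < max (x i) 0 / u i ↔ u i < x i := by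
      intro i
      rw [one_lt_div (hu0 i), lt_max_iff]
      simp [not_lt.2 (hu0 i).le]
    simp only [← hlt]
    constructor
    · exact exists_lt_of_lt_ciSup
    · rintro ⟨i, hi⟩
      exact hi.trans_le (le_ciSup (f := fun i => max (x i) 0 / u i) (Set.finite_range _).bddAbove i)
  · intro t ht x
    rw [Real.mul_iSup_of_nonneg ht.le]
    congr 1
    funext i
    rw [Pi.smul_apply, smul_eq_mul, mul_div_assoc', mul_max_of_nonneg _ _ ht.le, mul_zero]

end

/-! ### The closed form -/

/-- Bookkeeping of constants with `m = |A|`, `k = |Aᶜ|`, `n = ν + m`, `N = ν + d = n + k`. Here `q`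
and `Q` are the full and the `A`-block quadratic forms, `dA` and `dS` the determinants of the block
and of its Schur complement, `G₁ = Γ(n/2)`, `G₂ = Γ(N/2)`. The factors `G₁`, `Ψ₁` and all powers of
`Q` and `n` cancel. -/
theorem intensity_constants {ν n N q Q dA dS G₁ G₂ Ψ₁ Ψ₂ Φ₀ p : ℝ} (m k d : ℕ) (hν : 0 < ν)
    (hq : 0 < q) (hQ : 0 < Q) (hA : 0 < dA) (hS : 0 < dS) (hG : 0 < G₁) (hΨ : 0 < Ψ₁)
    (hΦ : 0 < Φ₀) (hn : n = ν + m) (hN : N = ν + d) (hd : d = m + k) :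
    G₂ / (G₁ * (n * Real.pi) ^ ((k : ℝ) / 2) * √((Q / n) ^ k * dS)) * (q / Q) ^ (-(N / 2)) /
        Ψ₁ * Ψ₂ *
      ((2 ^ ((ν - 2) / 2) * ν ^ (-(m : ℝ) + 1) * G₁ * Ψ₁ * p) /
        (Real.pi ^ ((m : ℝ) / 2) * √dA * Q ^ (n / 2) * Φ₀)) =
      (ν⁻¹ ^ m * p) * (ν * (√((2 * Real.pi) ^ d * (dA * dS)))⁻¹ / Φ₀ *
        (2 ^ (N / 2 - 1) * G₂ * q ^ (-(N / 2)) * Ψ₂)) := by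
  have hn0 : 0 < n := by rw [hn]; positivity
  have hπ := Real.pi_pos
  have hs : ∀ (c : ℝ) (j : ℕ), 0 < c → √(c ^ j) = c ^ ((j : ℝ) / 2) := fun c j hc => by
    rw [Real.sqrt_eq_rpow, ← Real.rpow_natCast, ← Real.rpow_mul hc.le, mul_one_div]
  have e1 : √((Q / n) ^ k * dS) = Q ^ ((k : ℝ) / 2) / n ^ ((k : ℝ) / 2) * √dS := by
    rw [Real.sqrt_mul (by positivity), hs _ _ (by positivity), Real.div_rpow hQ.le hn0.le]
  have e2 : √((2 * Real.pi) ^ d * (dA * dS)) = 2 ^ ((d : ℝ) / 2) *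
      (Real.pi ^ ((m : ℝ) / 2) * Real.pi ^ ((k : ℝ) / 2)) * (√dA * √dS) := by
    rw [Real.sqrt_mul (by positivity), hs _ _ (by positivity), Real.sqrt_mul hA.le,
      Real.mul_rpow two_pos.le hπ.le, ← Real.rpow_add hπ, hd]
    push_cast
    rw [add_div]
  have e3 : (q / Q) ^ (-(N / 2)) = q ^ (-(N / 2)) * (Q ^ (n / 2) * Q ^ ((k : ℝ) / 2)) := by
    rw [Real.div_rpow hq.le hQ.le, Real.rpow_neg hQ.le, div_inv_eq_mul, ← Real.rpow_add hQ]
    congr 2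
    rw [hN, hn, hd]
    push_cast
    ring
  have e4 : (2 : ℝ) ^ (N / 2 - 1) = 2 ^ ((ν - 2) / 2) * 2 ^ ((d : ℝ) / 2) := by
    rw [← Real.rpow_add two_pos]
    congr 1
    rw [hN]
    ring
  have e5 : ν ^ (-(m : ℝ) + 1) = (ν ^ m)⁻¹ * ν := by
    rw [Real.rpow_add hν, Real.rpow_neg hν.le, Real.rpow_natCast, Real.rpow_one]
  rw [e1, e2, e3, e4, e5, inv_pow, Real.mul_rpow hn0.le hπ.le]
  have := Real.rpow_pos_of_pos hn0 ((k : ℝ) / 2)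
  have := Real.rpow_pos_of_pos hπ ((k : ℝ) / 2)
  have := Real.rpow_pos_of_pos hπ ((m : ℝ) / 2)
  have := Real.rpow_pos_of_pos hQ ((k : ℝ) / 2)
  have := Real.rpow_pos_of_pos hQ (n / 2)
  have := Real.rpow_pos_of_pos (two_pos (α := ℝ)) ((d : ℝ) / 2)
  have := Real.sqrt_pos.2 hA
  have := Real.sqrt_pos.2 hS
  field_simp

theorem condQ_pos {κ : Type*} [DecidableEq κ] {Ω : Matrix κ κ ℝ} {ν : ℝ} {mp z : κ → ℝ}
    {A : Finset κ} (hΩ : Ω.PosDef) (hmp : ∀ i, 0 < mp i) (hz : ∀ i, 0 < z i)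
    (hA : A.Nonempty) :
    0 < condQ Ω ν mp z A := by
  refine quadForm_pos (block_posDef hΩ A).inv fun h => ?_
  obtain ⟨i, hi⟩ := hA
  exact (circ_pos (ν := ν) hmp hz i).ne' (congrFun h ⟨i, hi⟩)

section
variable {ι : Type*} [Fintype ι] [DecidableEq ι]

theorem dotProduct_eq_merged (Ω : Matrix ι ι ℝ) (hΩ : Ω.PosDef) (α x : ι → ℝ) (A : Finset ι) :
    α ⬝ᵥ x = restr Aᶜ α ⬝ᵥ (restr Aᶜ x - (block Ω Aᶜ A * (block Ω A A)⁻¹) *ᵥ restr A x) +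
      mergedSlant Ω α A ⬝ᵥ restr A x := by
  rw [dotProduct_eq_restr_add A, mergedSlant, dotProduct_sub, add_dotProduct,
    dotProduct_mulVec_comm (block Ω Aᶜ A * (block Ω A A)⁻¹), Matrix.transpose_mul,
    inv_transpose_of_posDef (block_posDef hΩ A), block_transpose hΩ,
    dotProduct_comm (restr A x)]
  ring

variable {Ω : Matrix ι ι ℝ} {α : ι → ℝ} {τ ν : ℝ} {mp z : ι → ℝ} {A : Finset ι}

/-- With `c = 1 + quadForm (condSchur Ω A) (restr Aᶜ α)`, both sides have denominator `√(c +
quadForm (block Ω A A) (mergedSlant Ω α A))` by the completed square. -/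
theorem margExtension_div_eq (hΩ : Ω.PosDef) :
    margExtension Ω α τ A / √(1 + quadForm (block Ω A A) (margSlant Ω α A)) =
      τ / √(1 + quadForm Ω α) := by
  have h1 := quadForm_nonneg (condSchur_posDef hΩ A) (restr Aᶜ α)
  have h2 := quadForm_nonneg (block_posDef hΩ A) (mergedSlant Ω α A)
  rw [margExtension, margSlant, quadForm_smul, div_div, ← Real.sqrt_mul (by positivity),
    quadForm_eq_restr hΩ α A, inv_pow, Real.sq_sqrt (by positivity)]
  congr 2
  field_simp
  ring

/-- This identifies the non-central `t` factor in the denominator of the conditional density with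
the one in the numerator of the marginal intensity. -/
theorem condExtension_div_eq :
    condExtension Ω α ν mp z A / √(1 + quadForm (condSchur Ω A) (restr Aᶜ α)) =
      alphaTilde Ω α ν mp z A * √(A.card + ν) := by
  rw [condExtension, alphaTilde, margSlant, smul_dotProduct, smul_eq_mul, add_comm (A.card : ℝ)]
  ring

/-- The factorisation of a joint intensity into marginal and conditional parts, pointwise in `y`.
Everything reduces to `q = Q +` the Schur form of the residual and to the matching splitting of `α
⬝ᵥ x`. -/
theorem extSkewTDensity_mul_marginalIntensity (hν : 0 < ν) (hΩ : Ω.PosDef)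
    (hmp : ∀ i, 0 < mp i) (hz : ∀ i, 0 < z i) (hA : A.Nonempty) (y : (Aᶜ : Finset ι) → ℝ) :
    extSkewTDensity (condLocation Ω ν mp z A) (condScale Ω ν mp z A) (condSlant Ω α A)
        (condExtension Ω α ν mp z A) (-τ) (condDof ν A) y * marginalIntensity Ω α τ ν mp z A =
      (ν⁻¹ ^ A.card * ∏ i ∈ A, (mp i * z i ^ (1 - ν)) ^ (1 / ν)) *
        exponentDensity Ω α τ ν (glue A (restr A (circ ν mp z)) y) := by
  set x := glue A (restr A (circ ν mp z)) y with hx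
  have hQ : 0 < condQ Ω ν mp z A := condQ_pos hΩ hmp hz hA
  have hS := condSchur_posDef hΩ A
  have hAp := block_posDef hΩ A
  have hn : 0 < condDof ν A := by unfold condDof; positivity
  have hc : 0 < condQ Ω ν mp z A / condDof ν A := div_pos hQ hn
  have hSc : (condScale Ω ν mp z A).PosDef := hS.smul hc
  set r := y - condLocation Ω ν mp z A with hr
  have hx0 : x ≠ 0 := by
    obtain ⟨i, hi⟩ := hA
    intro h
    have := congrFun h i
    rw [hx] at this
    simp only [glue, hi, dif_pos, restr, Pi.zero_apply] at this
    exact (circ_pos (ν := ν) hmp hz i).ne' this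
  have hq : 0 < quadForm Ω⁻¹ x := quadForm_pos hΩ.inv hx0
  have hqQ : quadForm Ω⁻¹ x = condQ Ω ν mp z A + quadForm (condSchur Ω A)⁻¹ r := by
    rw [quadForm_inv_eq_restr hΩ x A, hx, restr_glue, restr_compl_glue]
    rfl
  have hαx : α ⬝ᵥ x = restr Aᶜ α ⬝ᵥ r + mergedSlant Ω α A ⬝ᵥ restr A (circ ν mp z) := by
    rw [dotProduct_eq_merged Ω hΩ α x A, hx, restr_glue, restr_compl_glue]
    rfl
  have hquad : quadForm (condScale Ω ν mp z A)⁻¹ r =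
      condDof ν A / condQ Ω ν mp z A * quadForm (condSchur Ω A)⁻¹ r := by
    rw [condScale, quadForm_inv_smul (isUnit_det_of_posDef hS) hc.ne', inv_div]
  -- The scale `Q / (ν + |A|)` in `condScale` is chosen so that the kernel of the `t` density
  -- becomes the ratio `q / Q`.
  have hquad1 : 1 + quadForm (condScale Ω ν mp z A)⁻¹ r / condDof ν A =
      quadForm Ω⁻¹ x / condQ Ω ν mp z A := by
    rw [hquad, hqQ]
    field_simp
  have hz' : (fun i => (y i - condLocation Ω ν mp z A i) / √(condScale Ω ν mp z A i i)) =
      fun i => r i / √(condScale Ω ν mp z A i i) := rfl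
  have hslant : quadForm (correlation (condScale Ω ν mp z A)) (condSlant Ω α A) =
      quadForm (condSchur Ω A) (restr Aᶜ α) := by
    rw [condScale, correlation_smul _ hc, ← quadForm_correlation hS]
    rfl
  have hdot : condSlant Ω α A ⬝ᵥ (fun i => r i / √(condScale Ω ν mp z A i i)) =
      √(condDof ν A) / √(condQ Ω ν mp z A) * (restr Aᶜ α ⬝ᵥ r) := by
    simp only [dotProduct, Finset.mul_sum]
    refine Finset.sum_congr rfl fun i _ => ?_
    have h1 : 0 < √(condSchur Ω A i i) := Real.sqrt_pos.2 hS.diag_pos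
    have h2 := Real.sqrt_pos.2 hQ
    have h3 := Real.sqrt_pos.2 hn
    rw [condScale, Matrix.smul_apply, smul_eq_mul, Real.sqrt_mul hc.le, Real.sqrt_div hQ.le,
      condSlant]
    simp only [restr]
    field_simp
  have hcard : Fintype.card ι = A.card + Fintype.card (Aᶜ : Finset ι) := by
    rw [Fintype.card_coe, Finset.card_add_card_compl]
  have hN : condDof ν A + Fintype.card (Aᶜ : Finset ι) = ν + Fintype.card ι := by
    rw [hcard, condDof]
    push_cast
    ring
  have harg : (condSlant Ω α A ⬝ᵥ (fun i => r i / √(condScale Ω ν mp z A i i)) +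
        condExtension Ω α ν mp z A) *
      √((ν + Fintype.card ι) / (condDof ν A + quadForm (correlation (condScale Ω ν mp z A))⁻¹
        fun i => r i / √(condScale Ω ν mp z A i i))) =
      α ⬝ᵥ x / √(quadForm Ω⁻¹ x) * √(ν + Fintype.card ι) := by
    have h1 : condDof ν A + (quadForm (correlation (condScale Ω ν mp z A))⁻¹
        fun i => r i / √(condScale Ω ν mp z A i i)) =
        condDof ν A * quadForm Ω⁻¹ x / condQ Ω ν mp z A := by
      rw [quadForm_correlation_inv hSc, mul_div_assoc, ← hquad1]
      field_simp
    have h2 := Real.sqrt_pos.2 hQ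
    have h3 := Real.sqrt_pos.2 hn
    have h4 := Real.sqrt_pos.2 hq
    rw [h1, hdot, condExtension, hαx, Real.sqrt_div (by positivity),
      Real.sqrt_div (by positivity), Real.sqrt_mul hn.le]
    -- The `√(ν + A.card)` in `condExtension` is restated through `condDof` so that it cancels.
    change (_ + _ * √(condDof ν A) / _) * _ = _
    field_simp
  have hdet : (condScale Ω ν mp z A).det =
      (condQ Ω ν mp z A / condDof ν A) ^ Fintype.card (Aᶜ : Finset ι) * (condSchur Ω A).det := by
    rw [condScale, Matrix.det_smul]
  have hmn : (A.card : ℝ) + ν = condDof ν A := by rw [condDof, add_comm]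
  have hΨarg : -τ / √(1 + quadForm (condSchur Ω A) (restr Aᶜ α)) = -margExtension Ω α τ A := by
    rw [margExtension, neg_div]
  simp only [extSkewTDensity, multivariateTDensity, marginalIntensity, exponentDensity]
  rw [hz', hslant, hN, harg, hdet, hquad1, condExtension_div_eq, hΨarg,
    margExtension_div_eq hΩ, det_eq_block_mul_condSchur hΩ A, hmn]
  refine intensity_constants A.card (Fintype.card (Aᶜ : Finset ι)) (Fintype.card ι) hν hq hQ
    hAp.det_pos hS.det_pos (Real.Gamma_pos_of_pos (by positivity)) (noncentralTCDF_pos hn _ _)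
    (stdNormalCDF_pos _) rfl rfl hcard

/-- The factorisation integrated over `y`. When `A` is everything, the integral is over a single
point of volume one, so this case needs no separate treatment. -/
theorem condSkewTCDF_mul_marginalIntensity (hν : 0 < ν) (hΩ : Ω.PosDef)
    (hdiag : ∀ i, Ω i i = 1) (hmp : ∀ i, 0 < mp i) (hz : ∀ i, 0 < z i) (hA : A.Nonempty) :
    condSkewTCDF Ω α τ ν mp z A * marginalIntensity Ω α τ ν mp z A =
      (∏ i ∈ A, ν⁻¹ * (mp i * z i ^ (1 - ν)) ^ (1 / ν)) *
        (orthantIntegral (exponentDensity Ω α τ ν) A (circ ν mp z)).toReal := by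
  have hg := isTailDensity_exponentDensity (α := α) (τ := τ) hν hΩ hdiag
  have hmeas : Measurable fun y : (Aᶜ : Finset ι) → ℝ => glue A (restr A (circ ν mp z)) y := by
    refine measurable_pi_lambda _ fun i => ?_
    by_cases hi : i ∈ A
    · simp only [glue, hi, dif_pos]
      fun_prop
    · simp only [glue, hi, dif_neg, not_false_iff]
      fun_prop
  rw [condSkewTCDF, extSkewTCDF, ← integral_mul_const]
  simp_rw [extSkewTDensity_mul_marginalIntensity hν hΩ hmp hz hA]
  rw [integral_const_mul, orthantIntegral_eq, Finset.prod_mul_distrib, Finset.prod_const,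
    integral_eq_lintegral_of_nonneg_ae (ae_of_all _ fun y => hg.nonneg _)
      (hg.measurable.comp hmeas).aestronglyMeasurable]

/-! ### The partial derivatives -/

theorem circ_update {κ : Type*} [DecidableEq κ] (ν : ℝ) (mp z : κ → ℝ) (j : κ) (t : ℝ) :
    circ ν mp (Function.update z j t) =
      Function.update (circ ν mp z) j ((t * mp j) ^ (1 / ν)) := by
  funext i
  by_cases hi : i = j
  · subst hi
    simp [circ]
  · simp [circ, hi]

theorem update_pos {κ : Type*} [DecidableEq κ] {z : κ → ℝ} (hz : ∀ i, 0 < z i) (j : κ) {t : ℝ} (ht : 0 < t)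
    (i : κ) :
    0 < Function.update z j t i := by
  by_cases hi : i = j
  · subst hi
    simpa using ht
  · simpa [hi] using hz i

theorem hasDerivAt_circ {m t ν : ℝ} (hm : 0 < m) (ht : 0 < t) (hν : 0 < ν) :
    HasDerivAt (fun t => (t * m) ^ (1 / ν)) (ν⁻¹ * (m * t ^ (1 - ν)) ^ (1 / ν)) t := by
  have h := ((hasDerivAt_id t).mul_const m).rpow_const (p := 1 / ν) (Or.inl (by simp; grind))
  refine h.congr_deriv ?_
  have e1 : (m * t ^ (1 - ν)) ^ (1 / ν) = m ^ (1 / ν) * t ^ (1 / ν - 1) := by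
    rw [Real.mul_rpow hm.le (by positivity), ← Real.rpow_mul ht.le]
    congr 2
    field_simp
  rw [e1, id, Real.mul_rpow ht.le hm.le, Real.rpow_sub_one hm.ne']
  field_simp

/-- The chain-rule factors already collected involve only coordinates in `A`, so they are constant
in `z j`; the new derivative supplies the factor for `j`. -/
theorem hasDerivAt_neg_prod_mul_orthantIntegral {g : (ι → ℝ) → ℝ} {C r : ℝ}
    (hg : IsTailDensity g C r) (hν : 0 < ν) (hmp : ∀ i, 0 < mp i) (hz : ∀ i, 0 < z i)
    (hA : A.Nonempty) {j : ι} (hj : j ∉ A) :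
    HasDerivAt (fun t => -((∏ i ∈ A,
        ν⁻¹ * (mp i * (Function.update z j t) i ^ (1 - ν)) ^ (1 / ν)) *
          (orthantIntegral g A (circ ν mp (Function.update z j t))).toReal))
      (-((∏ i ∈ insert j A, ν⁻¹ * (mp i * z i ^ (1 - ν)) ^ (1 / ν)) *
          (orthantIntegral g (insert j A) (circ ν mp z)).toReal)) (z j) := by
  have hu := circ_pos (ν := ν) hmp hz
  have hprod : ∀ t, (∏ i ∈ A, ν⁻¹ * (mp i * (Function.update z j t) i ^ (1 - ν)) ^ (1 / ν)) =
      ∏ i ∈ A, ν⁻¹ * (mp i * z i ^ (1 - ν)) ^ (1 / ν) := by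
    intro t
    refine Finset.prod_congr rfl fun i hi => ?_
    rw [Function.update_of_ne (ne_of_mem_of_not_mem hi hj)]
  simp_rw [hprod, circ_update]
  have h := (hasDerivAt_orthantIntegral hg (circ ν mp z) hu hA hj (hu j)).comp (z j)
    (hasDerivAt_circ (hmp j) (hz j) hν)
  refine ((h.const_mul (∏ i ∈ A, ν⁻¹ * (mp i * z i ^ (1 - ν)) ^ (1 / ν))).neg).congr_deriv ?_
  rw [Function.update_eq_self, Finset.prod_insert hj]
  ring

theorem hasDerivAt_exceedanceIntegral_circ {g : (ι → ℝ) → ℝ} {C r : ℝ}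
    (hg : IsTailDensity g C r) (hν : 0 < ν) (hmp : ∀ i, 0 < mp i) (hz : ∀ i, 0 < z i) (j : ι) :
    HasDerivAt (fun t => (exceedanceIntegral g (circ ν mp (Function.update z j t))).toReal)
      (-((∏ i ∈ {j}, ν⁻¹ * (mp i * z i ^ (1 - ν)) ^ (1 / ν)) *
          (orthantIntegral g {j} (circ ν mp z)).toReal)) (z j) := by
  have hu := circ_pos (ν := ν) hmp hz
  simp_rw [circ_update]
  have h := (hasDerivAt_exceedanceIntegral hg (circ ν mp z) hu j (hu j)).comp (z j)
    (hasDerivAt_circ (hmp j) (hz j) hν)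
  refine h.congr_deriv ?_
  rw [Function.update_eq_self, Finset.prod_singleton]
  ring

variable {E : Type*} [MeasurableSpace E] {P : Measure E} {W : E → ι → ℝ}

theorem isIteratedPartial_exponentFunction (hν : 0 < ν) (hΩ : Ω.PosDef)
    (hdiag : ∀ i, Ω i i = 1) (hW : HasLaw W (extSkewNormal Ω α τ) P) (l : List ι)
    (hl : l.Nodup) (hne : l ≠ []) :
    IsIteratedPartial {z : ι → ℝ | ∀ i, 0 < z i} l (exponentFunction P W ν)
      (fun z => -(condSkewTCDF Ω α τ ν (plusMoment P W ν) z l.toFinset *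
        marginalIntensity Ω α τ ν (plusMoment P W ν) z l.toFinset)) := by
  have hg := isTailDensity_exponentDensity (α := α) (τ := τ) hν hΩ hdiag
  have hmp := plusMoment_pos hν hΩ hdiag hW
  induction l with
  | nil => exact absurd rfl hne
  | cons j l ih =>
    have : Nonempty ι := ⟨j⟩
    rw [List.nodup_cons] at hl
    have hjl : j ∉ l.toFinset := by simpa using hl.1
    -- The head of the list is the last variable differentiated. With an empty tail the function
    -- differentiated is `V` itself, an exceedance integral; otherwise it is minus an orthant
    -- integral with at least one frozen coordinate.
    rcases l.eq_nil_or_concat' with rfl | hl'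
    · refine ⟨exponentFunction P W ν, fun _ _ => rfl, fun z hz => ?_⟩
      dsimp only
      rw [condSkewTCDF_mul_marginalIntensity hν hΩ hdiag hmp hz (by simp)]
      refine (hasDerivAt_exceedanceIntegral_circ hg hν hmp hz j).congr_of_eventuallyEq ?_
      -- The integral representation holds only for positive coordinates, which suffices near `z j`.
      filter_upwards [Ioi_mem_nhds (hz j)] with t ht
      exact exponentFunction_eq hν hΩ hdiag hW (update_pos hz j ht)
    · have hl0 : l ≠ [] := by
        obtain ⟨a, b, rfl⟩ := hl'
        simp
      refine ⟨_, ih hl.2 hl0, fun z hz => ?_⟩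
      have hA : l.toFinset.Nonempty := List.toFinset_nonempty_iff l |>.2 hl0
      dsimp only
      rw [List.toFinset_cons, condSkewTCDF_mul_marginalIntensity hν hΩ hdiag hmp hz
        (Finset.insert_nonempty _ _)]
      refine (hasDerivAt_neg_prod_mul_orthantIntegral hg hν hmp hz hA hjl).congr_of_eventuallyEq ?_
      filter_upwards [Ioi_mem_nhds (hz j)] with t ht
      rw [condSkewTCDF_mul_marginalIntensity hν hΩ hdiag hmp (update_pos hz j ht) hA]

end

end ExtremalSkewT

end

open ExtremalSkewT in
theorem proposition3 {d : ℕ} (ν : ℝ) (hν : 0 < ν)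
    (Ω : Matrix (Fin d) (Fin d) ℝ) (hΩ : Ω.PosDef) (hdiag : ∀ i, Ω i i = 1)
    (α : Fin d → ℝ) (τ : ℝ)
    {E : Type*} [MeasurableSpace E] (P : MeasureTheory.Measure E)
    (W : E → Fin d → ℝ) (hW : ProbabilityTheory.HasLaw W (extSkewNormal Ω α τ) P)
    (l : List (Fin d)) (hl : l.Nodup) (hne : l ≠ []) :
    IsIteratedPartial {z : Fin d → ℝ | ∀ i, 0 < z i} l
      (exponentFunction P W ν)
      (fun z => -(condSkewTCDF Ω α τ ν (plusMoment P W ν) z l.toFinset *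
        marginalIntensity Ω α τ ν (plusMoment P W ν) z l.toFinset)) := by
  exact isIteratedPartial_exponentFunction hν hΩ hdiag hW l hl hne
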